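/- Let $m,r\ge 1$ and $n\ge 0$ be integers, $1\le p\le\infty$, $-\infty<a<b<\infty$ and $\varepsilon_0>0$. For an integer $N\ge1$ and a finite-dimensional complex normed space $E$, let $W_p^{N}([a,b];E)$ be the space of all $y\in C^{N-1}([a,b];E)$ such that $y^{(N-1)}$ is absolutely continuous on $[a,b]$ and $y^{(N)}\in L_p([a,b];E)$; let $W_p^0:=L_p$, and put $\|y\|_{N,p}:=\sum_{k=0}^{N}\|y^{(k)}\|_{p}$. Write $(W_p^N)^m:=W_p^N([a,b];\mathbb C^m)$ and $(W_p^N)^{m\times m}:=W_p^N([a,b];\mathbb C^{m\times m})$, where $\mathbb C^m$ and $\mathbb C^{rm}$ carry the Euclidean norm and $\mathbb C^{m\times m}$ the operator norm. For every $\varepsilon\in[0,\varepsilon_0)$ let matrix-valued functions $A_{r-j}(\cdot;\varepsilon)\in(W_p^n)^{m\times m}$, $j=1,\dots,r$, and a continuous linear operator $B(\varepsilon):(W_p^{n+r})^m\to\mathbb C^{rm}$ be given, and let $$L(\varepsilon)y:=y^{(r)}+\sum_{j=1}^{r}A_{r-j}(\cdot;\varepsilon)\,y^{(r-j)},\qquad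 y\in (W_p^{n+r})^m .$$ For $f(\cdot;\varepsilon)\in(W_p^n)^m$ and $c(\varepsilon)\in\mathbb C^{rm}$ consider the boundary-value problem $$L(\varepsilon)y(\cdot;\varepsilon)=f(\cdot;\varepsilon)\ \text{ on }(a,b),\qquad B(\varepsilon)y(\cdot;\varepsilon)=c(\varepsilon),\qquad(\ast)$$ where the solution $y(\cdot;\varepsilon)$ is sought in $(W_p^{n+r})^m$ and the differential equation holds everywhere on $(a,b)$ if $n\ge1$ and almost everywhere if $n=0$. Assume, with limits as $\varepsilon\to0+$: (0) the homogeneous problem $L(0)y=0$ on $(a,b)$, $B(0)y=0$ has only the trivial solution; (I) $A_{r-j}(\cdot;\varepsilon)\to A_{r-j}(\cdot;0)$ in $(W_p^n)^{m\times m}$ for each $j\in\{1,\dots,r\}$; (II) $B(\varepsilon)y\to B(0)y$ in $\mathbb C^{rm}$ for every $y\in(W_p^{n+r})^m$. Then there is $\varepsilon_1\in(0,\varepsilon_0)$ such that for every $\varepsilon\in[0,\varepsilon_1)$ and all right-hand sides $f(\cdot;\varepsilon)\in(W_p^n)^m$, $c(\varepsilon)\in\mathbb C^{rm}$ problem $(\ast)$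 has a unique solution $y(\cdot;\varepsilon)\in(W_p^{n+r})^m$; and there exist $\varepsilon_2\in(0,\varepsilon_1)$ and $\gamma_1,\gamma_2>0$ such that, for all right-hand sides and every $\varepsilon\in(0,\varepsilon_2)$, $$\gamma_1\,\widetilde d_{n,p}(\varepsilon)\le\|y(\cdot;0)-y(\cdot;\varepsilon)\|_{n+r,p}\le\gamma_2\,\widetilde d_{n,p}(\varepsilon),$$ where $$\widetilde d_{n,p}(\varepsilon):=\|L(\varepsilon)y(\cdot;0)-f(\cdot;\varepsilon)\|_{n,p}+\|B(\varepsilon)y(\cdot;0)-c(\varepsilon)\|_{\mathbb C^{rm}}.$$ The numbers $\varepsilon_2,\gamma_1,\gamma_2$ depend neither on the right-hand sides nor on the solutions $y(\cdot;0)$, $y(\cdot;\varepsilon)$. -/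

import Mathlib

open MeasureTheory Set Filter Topology
open scoped ENNReal Matrix.Norms.L2Operator

set_option linter.unusedSectionVars false

noncomputable section

/-- `IsSobolev N p a b y`: the function `y` belongs to the Sobolev space `W_p^N([a,b]; E)`. For
`N = 0` this is `L_p`; for `N ≥ 1` it says that `y` is in `C^(N-1)[a,b]`, that `y^(N-1)` is
absolutely continuous on `[a,b]`, and that `y^(N)` (which then exists almost everywhere) is in
`L_p[a,b]`. Derivatives are taken within `[a,b]`; the values of `y` outside `[a,b]` play no role. -/
def IsSobolev {E : Type*} [NormedAddCommGroup E] [NormedSpace ℝ E] (N : ℕ) (p : ℝ≥0∞) (a b : ℝ)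
    (y : ℝ → E) : Prop :=
  match N with
  | 0 => MemLp y p (volume.restrict (Icc a b))
  | k + 1 =>
      ContDiffOn ℝ k y (Icc a b) ∧
      AbsolutelyContinuousOnInterval (iteratedDerivWithin k y (Icc a b)) a b ∧
      MemLp (iteratedDerivWithin (k + 1) y (Icc a b)) p (volume.restrict (Icc a b))

/-! Closure properties of Sobolev functions, needed to form the spaces and the operators below. -/

namespace IsSobolev

section Real

variable {E F G : Type*} [NormedAddCommGroup E] [NormedSpace ℝ E]
  [NormedAddCommGroup F] [NormedSpace ℝ F] [NormedAddCommGroup G] [NormedSpace ℝ G]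
  {N : ℕ} {p : ℝ≥0∞} {a b : ℝ} {y z : ℝ → E}

theorem one_iff : IsSobolev 1 p a b y ↔ ContinuousOn y (Icc a b) ∧
    AbsolutelyContinuousOnInterval y a b ∧
    MemLp (derivWithin y (Icc a b)) p (volume.restrict (Icc a b)) := by
  simp only [IsSobolev, Nat.cast_zero, contDiffOn_zero, iteratedDerivWithin_zero,
    iteratedDerivWithin_succ]

theorem add_two_iff (hab : a < b) : IsSobolev (N + 2) p a b y ↔
    DifferentiableOn ℝ y (Icc a b) ∧ IsSobolev (N + 1) p a b (derivWithin y (Icc a b)) := by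
  simp only [IsSobolev]
  rw [Nat.cast_add, Nat.cast_one, contDiffOn_succ_iff_derivWithin (uniqueDiffOn_Icc hab),
    iteratedDerivWithin_succ' (n := N), iteratedDerivWithin_succ' (n := N + 1)]
  simp [and_assoc]

theorem derivWithin_of_succ (hab : a < b) (h : IsSobolev (N + 1) p a b y) :
    IsSobolev N p a b (derivWithin y (Icc a b)) := by
  cases N with
  | zero => exact (one_iff.1 h).2.2
  | succ N => exact ((add_two_iff hab).1 h).2

theorem continuousOn (h : IsSobolev (N + 1) p a b y) : ContinuousOn y (Icc a b) :=
  h.1.continuousOn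

theorem ae_of_forall {P : ℝ → Prop} (h : ∀ t ∈ Icc a b, P t) :
    ∀ᵐ t ∂(volume.restrict (Icc a b)), P t :=
  (ae_restrict_iff' measurableSet_Icc).2 (Eventually.of_forall h)

theorem memLp_of_continuousOn (h : ContinuousOn y (Icc a b)) :
    MemLp y p (volume.restrict (Icc a b)) := by
  obtain ⟨C, hC⟩ := isCompact_Icc.exists_bound_of_continuousOn h
  exact MemLp.of_bound (h.aestronglyMeasurable_of_isCompact isCompact_Icc measurableSet_Icc) C
    (ae_of_forall hC)

theorem ac_congr (hab : a < b) (h : AbsolutelyContinuousOnInterval y a b)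
    (hz : EqOn y z (Icc a b)) : AbsolutelyContinuousOnInterval z a b := by
  refine Tendsto.congr' ?_ h
  refine (eventually_inf_principal).2 (Eventually.of_forall fun I hI => ?_)
  refine Finset.sum_congr rfl fun i hi => ?_
  have h1 := hI.1 i hi
  rw [uIcc_of_le hab.le] at h1
  rw [hz h1.1, hz h1.2]

theorem congr (hab : a < b) (h : IsSobolev N p a b y) (hz : EqOn y z (Icc a b)) :
    IsSobolev N p a b z := by
  have key : ∀ k, iteratedDerivWithin k y (Icc a b)
      =ᵐ[volume.restrict (Icc a b)] iteratedDerivWithin k z (Icc a b) := fun k =>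
    ae_of_forall fun t ht => iteratedDerivWithin_congr hz ht
  cases N with
  | zero => exact (memLp_congr_ae (by simpa using key 0)).1 h
  | succ N =>
    exact ⟨h.1.congr hz.symm, ac_congr hab h.2.1 (iteratedDerivWithin_congr hz),
      (memLp_congr_ae (key _)).1 h.2.2⟩

theorem of_succ (hab : a < b) (h : IsSobolev (N + 1) p a b y) : IsSobolev N p a b y := by
  induction N generalizing y with
  | zero => exact memLp_of_continuousOn h.continuousOn
  | succ N ih =>
    have h' := (add_two_iff hab).1 h
    cases N with
    | zero =>
      refine one_iff.2 ⟨h'.1.continuousOn, ?_, ih h'.2⟩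
      refine ContDiffOn.absolutelyContinuousOnInterval ?_
      rw [uIcc_of_le hab.le, contDiffOn_one_iff_derivWithin (uniqueDiffOn_Icc hab)]
      exact ⟨h'.1, h'.2.continuousOn⟩
    | succ N => exact (add_two_iff hab).2 ⟨h'.1, ih h'.2⟩

theorem of_add (hab : a < b) (k : ℕ) (h : IsSobolev (N + k) p a b y) : IsSobolev N p a b y := by
  induction k with
  | zero => exact h
  | succ k ih => exact ih (of_succ hab h)

theorem iteratedDerivWithin_of_add (hab : a < b) (k : ℕ) (h : IsSobolev (N + k) p a b y) :
    IsSobolev N p a b (iteratedDerivWithin k y (Icc a b)) := by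
  induction k generalizing y with
  | zero => simpa using h
  | succ k ih =>
    rw [iteratedDerivWithin_succ']
    exact ih (derivWithin_of_succ hab h)

theorem memLp_iteratedDerivWithin (hab : a < b) {k : ℕ} (hk : k ≤ N) (h : IsSobolev N p a b y) :
    MemLp (iteratedDerivWithin k y (Icc a b)) p (volume.restrict (Icc a b)) := by
  obtain ⟨j, rfl⟩ := Nat.exists_eq_add_of_le hk
  have h1 : IsSobolev j p a b (iteratedDerivWithin k y (Icc a b)) :=
    iteratedDerivWithin_of_add hab k (by rwa [add_comm])
  exact of_add (N := 0) hab j (by rwa [zero_add])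

theorem ae_differentiableWithinAt [FiniteDimensional ℝ E] (hab : a < b)
    (h : IsSobolev (N + 1) p a b y) :
    ∀ᵐ t ∂(volume.restrict (Icc a b)), DifferentiableWithinAt ℝ y (Icc a b) t := by
  cases N with
  | zero =>
    have h1 := (one_iff.1 h).2.1.boundedVariationOn
    rw [uIcc_of_le hab.le] at h1
    exact h1.locallyBoundedVariationOn.ae_differentiableWithinAt measurableSet_Icc
  | succ N => exact ae_of_forall ((add_two_iff hab).1 h).1

theorem ae_derivWithin_add [FiniteDimensional ℝ E] (hab : a < b)
    (hy : IsSobolev (N + 1) p a b y) (hz : IsSobolev (N + 1) p a b z) :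
    derivWithin (y + z) (Icc a b) =ᵐ[volume.restrict (Icc a b)]
      derivWithin y (Icc a b) + derivWithin z (Icc a b) := by
  filter_upwards [ae_differentiableWithinAt hab hy, ae_differentiableWithinAt hab hz] with t h1 h2
  exact derivWithin_add h1 h2

theorem ae_iteratedDerivWithin_add [FiniteDimensional ℝ E] (hab : a < b) {k : ℕ} (hk : k ≤ N)
    (hy : IsSobolev N p a b y) (hz : IsSobolev N p a b z) :
    iteratedDerivWithin k (y + z) (Icc a b) =ᵐ[volume.restrict (Icc a b)]
      iteratedDerivWithin k y (Icc a b) + iteratedDerivWithin k z (Icc a b) := by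
  induction N generalizing y z k with
  | zero => obtain rfl : k = 0 := by omega
            simp
  | succ N ih =>
    cases k with
    | zero => simp
    | succ k =>
      cases N with
      | zero =>
        obtain rfl : k = 0 := by omega
        simpa [iteratedDerivWithin_succ] using ae_derivWithin_add hab hy hz
      | succ N =>
        have h1 := (add_two_iff hab).1 hy
        have h2 := (add_two_iff hab).1 hz
        simp only [iteratedDerivWithin_succ']
        refine EventuallyEq.trans ?_ (ih (k := k) (by omega) h1.2 h2.2)
        refine ae_of_forall fun t ht => iteratedDerivWithin_congr ?_ ht
        intro s hs
        exact derivWithin_add (h1.1 s hs) (h2.1 s hs)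

theorem add [FiniteDimensional ℝ E] (hab : a < b)
    (hy : IsSobolev N p a b y) (hz : IsSobolev N p a b z) : IsSobolev N p a b (y + z) := by
  induction N generalizing y z with
  | zero => exact MemLp.add hy hz
  | succ N ih =>
    cases N with
    | zero =>
      have h1 := one_iff.1 hy
      have h2 := one_iff.1 hz
      exact one_iff.2 ⟨h1.1.add h2.1, h1.2.1.add h2.2.1,
        (memLp_congr_ae (ae_derivWithin_add hab hy hz)).2 (h1.2.2.add h2.2.2)⟩
    | succ N =>
      have h1 := (add_two_iff hab).1 hy
      have h2 := (add_two_iff hab).1 hz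
      refine (add_two_iff hab).2 ⟨h1.1.add h2.1, (ih h1.2 h2.2).congr hab fun s hs => ?_⟩
      exact (derivWithin_add (h1.1 s hs) (h2.1 s hs)).symm

theorem ac_bilin (L : E →L[ℝ] F →L[ℝ] G) {f : ℝ → E} {g : ℝ → F}
    (hf : AbsolutelyContinuousOnInterval f a b) (hg : AbsolutelyContinuousOnInterval g a b) :
    AbsolutelyContinuousOnInterval (fun t => L (f t) (g t)) a b := by
  obtain ⟨C, hC⟩ := hf.exists_bound
  obtain ⟨D, hD⟩ := hg.exists_bound
  unfold AbsolutelyContinuousOnInterval at hf hg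
  apply squeeze_zero' ?_ ?_
    (by simpa using (hg.const_mul (‖L‖ * C)).add (hf.const_mul (‖L‖ * D)))
  · exact Filter.Eventually.of_forall <| fun _ ↦ Finset.sum_nonneg (fun i hi ↦ dist_nonneg)
  rw [eventually_inf_principal]
  refine Eventually.of_forall fun I hI => ?_
  simp only [Finset.mul_sum, ← Finset.sum_add_distrib]
  refine Finset.sum_le_sum fun i hi => ?_
  have h1 := hI.1 i hi
  set s := (I.2 i).1
  set t := (I.2 i).2
  have e : L (f s) (g s) - L (f t) (g t) = L (f s) (g s - g t) + L (f s - f t) (g t) := by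
    simp
  rw [dist_eq_norm, dist_eq_norm, dist_eq_norm, e]
  refine (norm_add_le _ _).trans (add_le_add ?_ ?_)
  · refine (L.le_opNorm₂ _ _).trans ?_
    gcongr
    exact hC _ h1.1
  · refine (L.le_opNorm₂ _ _).trans (le_of_le_of_eq (b := ‖L‖ * ‖f s - f t‖ * D) ?_ (by ring))
    gcongr
    exact hD _ h1.2

theorem bilin [FiniteDimensional ℝ E] [FiniteDimensional ℝ F] [FiniteDimensional ℝ G]
    (hab : a < b) (L : E →L[ℝ] F →L[ℝ] G) {f : ℝ → E} {g : ℝ → F}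
    (hf : IsSobolev N p a b f) (hg : IsSobolev (N + 1) p a b g) :
    IsSobolev N p a b (fun t => L (f t) (g t)) := by
  induction N generalizing f g with
  | zero =>
    exact L.memLp_of_bilin (q := ∞) p hf (memLp_of_continuousOn hg.continuousOn)
  | succ N ih =>
    have i1 := ih (derivWithin_of_succ hab hf) (of_succ hab hg)
    have i2 := ih (of_succ hab hf) (derivWithin_of_succ hab hg)
    have hg' := (add_two_iff hab).1 hg
    have key : ∀ t, DifferentiableWithinAt ℝ f (Icc a b) t →
        DifferentiableWithinAt ℝ g (Icc a b) t →
        derivWithin (fun t => L (f t) (g t)) (Icc a b) t =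
        ((fun t => L (derivWithin f (Icc a b) t) (g t)) +
        (fun t => L (f t) (derivWithin g (Icc a b) t))) t := by
      intro t h1 h2
      rw [L.derivWithin_of_bilinear h1 h2, Pi.add_apply, add_comm]
    cases N with
    | zero =>
      have hf' := one_iff.1 hf
      have hg1 := one_iff.1 (of_succ hab hg)
      refine one_iff.2 ⟨?_, ac_bilin L hf'.2.1 hg1.2.1, ?_⟩
      · exact L.continuous₂.comp_continuousOn (hf'.1.prodMk hg1.1)
      · refine (memLp_congr_ae ?_).2 (MemLp.add i1 i2)
        filter_upwards [ae_differentiableWithinAt hab hf, ae_differentiableWithinAt hab hg]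
          with t h1 h2
        exact key t h1 h2
    | succ N =>
      have hf' := (add_two_iff hab).1 hf
      refine (add_two_iff hab).2 ⟨fun t ht => ?_, (i1.add hab i2).congr hab fun t ht => ?_⟩
      · exact (L.hasDerivWithinAt_of_bilinear (hf'.1 t ht).hasDerivWithinAt
          (hg'.1 t ht).hasDerivWithinAt).differentiableWithinAt
      · exact (key t (hf'.1 t ht) (hg'.1 t ht)).symm

end Real

section Complex

variable {E : Type*} [NormedAddCommGroup E] [NormedSpace ℂ E]
  {N : ℕ} {p : ℝ≥0∞} {a b : ℝ} {y : ℝ → E}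

theorem derivWithin_smul (c : ℂ) :
    derivWithin (c • y) (Icc a b) = c • derivWithin y (Icc a b) := by
  ext t
  exact derivWithin_const_smul_field c y

theorem iteratedDerivWithin_smul (c : ℂ) (k : ℕ) :
    iteratedDerivWithin k (c • y) (Icc a b) = c • iteratedDerivWithin k y (Icc a b) := by
  induction k generalizing y with
  | zero => simp
  | succ k ih => rw [iteratedDerivWithin_succ', iteratedDerivWithin_succ', derivWithin_smul, ih]

theorem smul (c : ℂ) (h : IsSobolev N p a b y) : IsSobolev N p a b (c • y) := by
  cases N with
  | zero => exact MemLp.const_smul h c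
  | succ N =>
    refine ⟨h.1.const_smul c, ?_, ?_⟩
    · rw [iteratedDerivWithin_smul]
      exact h.2.1.const_smul c
    · rw [iteratedDerivWithin_smul]
      exact h.2.2.const_smul c

theorem zero : IsSobolev N p a b (0 : ℝ → E) := by
  have e : ∀ k, iteratedDerivWithin k (0 : ℝ → E) (Icc a b) = 0 := fun k => by
    ext t; exact iteratedDerivWithin_const_zero
  cases N with
  | zero => exact MemLp.zero
  | succ N =>
    refine ⟨contDiffOn_const, ?_, ?_⟩
    · rw [e]
      exact (LipschitzWith.const (0 : E)).lipschitzOnWith.absolutelyContinuousOnInterval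
    · rw [e]
      exact MemLp.zero

end Complex

end IsSobolev

/-! ### Sobolev spaces -/

section Space

variable {E : Type*} [NormedAddCommGroup E] [NormedSpace ℂ E] [FiniteDimensional ℝ E]

/-- The functions of class `W_p^N` on `[a,b]`, as a complex linear space. -/
def sobolevSubmodule (E : Type*) [NormedAddCommGroup E] [NormedSpace ℂ E] [FiniteDimensional ℝ E]
    {a b : ℝ} (hab : a < b) (N : ℕ) (p : ℝ≥0∞) : Submodule ℂ (ℝ → E) where
  carrier := {y | IsSobolev N p a b y}
  add_mem' := fun h1 h2 => h1.add hab h2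
  zero_mem' := IsSobolev.zero
  smul_mem' := fun c _ h => h.smul c

/-- The Sobolev space `W_p^N([a,b]; E)`. Its elements are functions on `ℝ` of which only the
restriction to `[a,b]` matters (up to null sets if `N = 0`): two functions that agree there are at
distance `0`. It is a separate type so that it carries the Sobolev norm and not the topology of
pointwise convergence. -/
def SobolevSpace (E : Type*) [NormedAddCommGroup E] [NormedSpace ℂ E] [FiniteDimensional ℝ E]
    {a b : ℝ} (hab : a < b) (N : ℕ) (p : ℝ≥0∞) : Type _ :=
  ↥(sobolevSubmodule E hab N p)

namespace SobolevSpace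

variable {a b : ℝ} {hab : a < b} {N : ℕ} {p : ℝ≥0∞}

instance : AddCommGroup (SobolevSpace E hab N p) :=
  inferInstanceAs (AddCommGroup ↥(sobolevSubmodule E hab N p))

instance : Module ℂ (SobolevSpace E hab N p) :=
  inferInstanceAs (Module ℂ ↥(sobolevSubmodule E hab N p))

instance : CoeFun (SobolevSpace E hab N p) fun _ => ℝ → E := ⟨fun y => y.1⟩

theorem isSobolev (y : SobolevSpace E hab N p) : IsSobolev N p a b y := y.2

/-- The `k`-th derivative of `y` on `[a,b]`. -/
def deriv (k : ℕ) (y : SobolevSpace E hab N p) : ℝ → E := iteratedDerivWithin k y (Icc a b)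

/-- The `L_p` norm on `[a,b]` of the `k`-th derivative of `y`. -/
def derivNorm (k : ℕ) (y : SobolevSpace E hab N p) : ℝ :=
  (eLpNorm (y.deriv k) p (volume.restrict (Icc a b))).toReal

theorem memLp_deriv {k : ℕ} (hk : k ≤ N) (y : SobolevSpace E hab N p) :
    MemLp (y.deriv k) p (volume.restrict (Icc a b)) :=
  y.isSobolev.memLp_iteratedDerivWithin hab hk

theorem derivNorm_smul (k : ℕ) (c : ℂ) (y : SobolevSpace E hab N p) :
    derivNorm k (c • y) = ‖c‖ * derivNorm k y := by
  have e : (c • y).deriv k = c • y.deriv k := IsSobolev.iteratedDerivWithin_smul c k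
  simp [derivNorm, e, eLpNorm_const_smul]

theorem derivNorm_add_le [Fact (1 ≤ p)] {k : ℕ} (hk : k ≤ N) (y z : SobolevSpace E hab N p) :
    derivNorm k (y + z) ≤ derivNorm k y + derivNorm k z := by
  have hy := memLp_deriv hk y
  have hz := memLp_deriv hk z
  have e : (y + z).deriv k =ᵐ[volume.restrict (Icc a b)] y.deriv k + z.deriv k :=
    IsSobolev.ae_iteratedDerivWithin_add hab hk y.isSobolev z.isSobolev
  rw [derivNorm, derivNorm, derivNorm, eLpNorm_congr_ae e,
    ← ENNReal.toReal_add hy.eLpNorm_ne_top hz.eLpNorm_ne_top]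
  exact ENNReal.toReal_mono (ENNReal.add_ne_top.2 ⟨hy.eLpNorm_ne_top, hz.eLpNorm_ne_top⟩)
    (eLpNorm_add_le hy.1 hz.1 Fact.out)

/-- The Sobolev norm `‖y‖_{N,p} = ∑_{k=0}^N ‖y^(k)‖_p`. -/
instance : Norm (SobolevSpace E hab N p) :=
  ⟨fun y => ∑ k ∈ Finset.range (N + 1), derivNorm k y⟩

theorem norm_def (y : SobolevSpace E hab N p) :
    ‖y‖ = ∑ k ∈ Finset.range (N + 1), derivNorm k y := rfl

theorem norm_smul_eq (c : ℂ) (y : SobolevSpace E hab N p) : ‖c • y‖ = ‖c‖ * ‖y‖ := by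
  simp only [norm_def, derivNorm_smul, Finset.mul_sum]

/-- The metric is `dist y z = ‖y - z‖`; it is a pseudometric because functions that agree on
`[a,b]` (almost everywhere if `N = 0`) are not identified. -/
instance [Fact (1 ≤ p)] : SeminormedAddCommGroup (SobolevSpace E hab N p) :=
  SeminormedAddCommGroup.ofCore (𝕜 := ℂ)
    { norm_nonneg := fun _ => Finset.sum_nonneg fun _ _ => ENNReal.toReal_nonneg
      norm_smul := norm_smul_eq
      norm_triangle := fun y z => by
        simp only [norm_def, ← Finset.sum_add_distrib]
        exact Finset.sum_le_sum fun k hk =>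
          derivNorm_add_le (by simpa [Nat.lt_succ_iff] using hk) y z }

instance [Fact (1 ≤ p)] : NormedSpace ℂ (SobolevSpace E hab N p) where
  norm_smul_le c y := (norm_smul_eq c y).le

end SobolevSpace

end Space

/-! ### The boundary-value problem -/

namespace BVP

/-- Complex `m`-vectors, with the Euclidean norm. -/
abbrev Vec (m : ℕ) : Type := EuclideanSpace ℂ (Fin m)

/-- Complex `m × m` matrices, with the operator norm. -/
abbrev Mat (m : ℕ) : Type := Matrix (Fin m) (Fin m) ℂ

/-- The product of a matrix and a vector, as a real-bilinear continuous map. -/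
def mulVecL (m : ℕ) : Mat m →L[ℝ] Vec m →L[ℝ] Vec m :=
  LinearMap.mkContinuous₂
    (LinearMap.mk₂ ℝ (fun (M : Mat m) (v : Vec m) => WithLp.toLp 2 (M.mulVec v.ofLp))
      (fun M M' v => by ext i; simp [Matrix.add_mulVec])
      (fun c M v => by ext i; simp [Matrix.smul_mulVec])
      (fun M v v' => by ext i; simp [Matrix.mulVec_add])
      (fun c M v => by ext i; simp [Matrix.mulVec_smul])) 1
    (fun M v => by simpa using M.l2_opNorm_mulVec v)

variable {m n r : ℕ} {a b : ℝ} {hab : a < b} {p : ℝ≥0∞}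

/-- The function `t ↦ y^(r)(t) + ∑_{j<r} A_j(t) y^(j)(t)`. -/
def diffExpr (A : Fin r → SobolevSpace (Mat m) hab n p)
    (y : SobolevSpace (Vec m) hab (n + r) p) (t : ℝ) : Vec m :=
  y.deriv r t + ∑ j : Fin r, WithLp.toLp 2 ((A j t).mulVec (y.deriv j t).ofLp)

theorem isSobolev_diffExpr (A : Fin r → SobolevSpace (Mat m) hab n p)
    (y : SobolevSpace (Vec m) hab (n + r) p) : IsSobolev n p a b (diffExpr A y) := by
  have h1 : IsSobolev n p a b (y.deriv r) := y.isSobolev.iteratedDerivWithin_of_add hab r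
  have h2 : ∀ j : Fin r, IsSobolev n p a b
      (fun t => WithLp.toLp 2 ((A j t).mulVec (y.deriv j t).ofLp)) := fun j => by
    refine IsSobolev.bilin hab (mulVecL m) (A j).isSobolev ?_
    have h3 : IsSobolev (n + 1 + (r - (j + 1)) + j) p a b y := by
      have : n + 1 + (r - (j + 1)) + j = n + r := by omega
      rw [this]
      exact y.isSobolev
    exact (h3.iteratedDerivWithin_of_add hab j).of_add hab _
  have h3 : IsSobolev n p a b
      (∑ j : Fin r, fun t => WithLp.toLp 2 ((A j t).mulVec (y.deriv j t).ofLp)) :=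
    (sobolevSubmodule (Vec m) hab n p).sum_mem fun j _ => h2 j
  exact (h1.add hab h3).congr hab fun t _ => by simp [diffExpr, Finset.sum_apply]

/-- The differential operator `L y = y^(r) + ∑_{j<r} A_j y^(j)`, from `(W_p^{n+r})^m` to
`(W_p^n)^m`. -/
def diffOp (A : Fin r → SobolevSpace (Mat m) hab n p)
    (y : SobolevSpace (Vec m) hab (n + r) p) : SobolevSpace (Vec m) hab n p :=
  ⟨diffExpr A y, isSobolev_diffExpr A y⟩

/-- Two functions of class `W_p^n` agree on `(a,b)`: everywhere if `n ≥ 1`, almost everywhere if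
`n = 0`. -/
def EqOnInterval (g h : SobolevSpace (Vec m) hab n p) : Prop :=
  if n = 0 then ∀ᵐ t ∂(volume.restrict (Ioo a b)), g t = h t else ∀ t ∈ Ioo a b, g t = h t

/-- `y` is a solution of the boundary-value problem `L y = f` on `(a,b)`, `B y = c`. -/
def IsSolution [Fact (1 ≤ p)] (A : Fin r → SobolevSpace (Mat m) hab n p)
    (B : SobolevSpace (Vec m) hab (n + r) p →L[ℂ] Vec (r * m))
    (f : SobolevSpace (Vec m) hab n p) (c : Vec (r * m))
    (y : SobolevSpace (Vec m) hab (n + r) p) : Prop :=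
  EqOnInterval (diffOp A y) f ∧ B y = c

/-- The boundary-value problem has, for all right-hand sides, a solution, and only one as a
function on `[a,b]`. -/
def UniquelySolvable [Fact (1 ≤ p)] (A : Fin r → SobolevSpace (Mat m) hab n p)
    (B : SobolevSpace (Vec m) hab (n + r) p →L[ℂ] Vec (r * m)) : Prop :=
  ∀ f c, (∃ y, IsSolution A B f c y) ∧
    ∀ y z, IsSolution A B f c y → IsSolution A B f c z → EqOn y z (Icc a b)

/-- The homogeneous boundary-value problem has only the trivial solution. -/
def OnlyTrivialSolution [Fact (1 ≤ p)] (A : Fin r → SobolevSpace (Mat m) hab n p)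
    (B : SobolevSpace (Vec m) hab (n + r) p →L[ℂ] Vec (r * m)) : Prop :=
  ∀ y, IsSolution A B 0 0 y → EqOn y 0 (Icc a b)

/-- The discrepancy `‖L y - f‖_{n,p} + ‖B y - c‖` of `y` in the boundary-value problem. -/
def discrepancy [Fact (1 ≤ p)] (A : Fin r → SobolevSpace (Mat m) hab n p)
    (B : SobolevSpace (Vec m) hab (n + r) p →L[ℂ] Vec (r * m))
    (f : SobolevSpace (Vec m) hab n p) (c : Vec (r * m))
    (y : SobolevSpace (Vec m) hab (n + r) p) : ℝ :=
  ‖diffOp A y - f‖ + ‖B y - c‖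

end BVP

end

/-! After identifying functions at distance zero, the problem becomes one equation `T(ε) y = (f, c)`
for `T(ε) = (L(ε), B(ε))`, acting between the Banach spaces `X = W_p^{n+r}` and `Y × F`, with `Y =
W_p^n` and `F = ℂ^{rm}`. If `y(ε)` solves the problem at `ε`, the discrepancy of `y(0)` is the norm
of `T(ε)(y(0) - y(ε))`. Everything therefore follows once `T(ε)` is bijective with two-sided bounds
uniform in small `ε`.

At `ε = 0`, injectivity is assumption (0). For surjectivity, the Cauchy problem for `L(0)` is
solvable in `W_p^{n+r}`: pass to the companion first-order system, solve the Volterra equation by a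
contraction in a weighted sup norm, and bootstrap the regularity. A linear choice of homogeneous
solutions with prescribed initial values turns `B(0)` into an injective, hence surjective,
endomorphism of an `rm`-dimensional space; this corrects any particular solution.

For small `ε > 0`, the product estimate in Sobolev spaces makes `L(ε)` converge in operator norm,
but `B(ε)` converges only strongly, so `T(ε)` need not converge in norm. Write `T(0)⁻¹(f, c) = R f +
σ c` and `P = B(ε) - B(0)`. Composing with the triangular bijection `J (f, c) = (f, c - P R f)`
leaves `T(0)⁻¹ J T(ε) = 1 + T(0)⁻¹ (L(ε) - L(0), P σ B(0) - P R (L(ε) - L(0)))`. Here `P σ → 0` in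
norm because `F` is finite-dimensional, and `P` is bounded by Banach–Steinhaus. The composite tends
to `1` and is invertible with bounded inverse. The key lemma is `eventually_bijective_prod`. -/

noncomputable section

/-! ### Vector-valued absolutely continuous functions as primitives. -/

section AbsoluteContinuity

variable {E : Type*} [NormedAddCommGroup E] [NormedSpace ℝ E] {a b : ℝ} {p : ℝ≥0∞}

theorem intervalIntegrable_of_memLp_Icc {g : ℝ → E} (hp : 1 ≤ p) (hab : a ≤ b)
    (hg : MemLp g p (volume.restrict (Icc a b))) : IntervalIntegrable g volume a b := by
  rw [intervalIntegrable_iff_integrableOn_Icc_of_le hab]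
  exact hg.integrable hp

theorem IntervalIntegrable.mono_Icc {g : ℝ → E} (hg : IntervalIntegrable g volume a b)
    {s t : ℝ} (hs : s ∈ Icc a b) (ht : t ∈ Icc a b) : IntervalIntegrable g volume s t :=
  hg.mono_set (by rw [uIcc_of_le (hs.1.trans hs.2)]; exact uIcc_subset_Icc hs ht)

/-- The increments are dominated by those of the primitive of `‖g‖`, which reduces the claim to the
scalar case. -/
theorem absolutelyContinuousOnInterval_integral (hab : a ≤ b) {g : ℝ → E}
    (hg : IntervalIntegrable g volume a b) :
    AbsolutelyContinuousOnInterval (fun t => ∫ s in a..t, g s) a b := by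
  have h := hg.norm.absolutelyContinuousOnInterval_intervalIntegral (c := a) left_mem_uIcc
  refine squeeze_zero' (Eventually.of_forall fun _ => Finset.sum_nonneg fun _ _ => dist_nonneg)
    ?_ h
  rw [eventually_inf_principal]
  refine Eventually.of_forall fun I hI => Finset.sum_le_sum fun i hi => ?_
  have h1 := hI.1 i hi
  rw [uIcc_of_le hab] at h1
  have ha : a ∈ Icc a b := left_mem_Icc.2 hab
  rw [dist_eq_norm, dist_eq_norm, intervalIntegral.integral_interval_sub_left
    (hg.mono_Icc ha h1.1) (hg.mono_Icc ha h1.2), intervalIntegral.integral_interval_sub_left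
    (hg.norm.mono_Icc ha h1.1) (hg.norm.mono_Icc ha h1.2)]
  exact intervalIntegral.norm_integral_le_abs_integral_norm

theorem ae_mem_Ioo_restrict_Icc (a b : ℝ) : ∀ᵐ t ∂(volume.restrict (Icc a b)), t ∈ Ioo a b := by
  rw [← restrict_Ioo_eq_restrict_Icc]
  exact ae_restrict_mem measurableSet_Ioo

theorem ae_hasDerivAt_integral_restrict_Icc [CompleteSpace E] (hab : a ≤ b) {g : ℝ → E}
    (hg : IntervalIntegrable g volume a b) :
    ∀ᵐ t ∂(volume.restrict (Icc a b)), HasDerivAt (fun t => ∫ s in a..t, g s) (g t) t := by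
  rw [ae_restrict_iff' measurableSet_Icc]
  filter_upwards [hg.ae_hasDerivAt_integral] with t ht h
  rw [uIcc_of_le hab] at ht
  exact ht h a (left_mem_Icc.2 hab)

/-- The difference of `y` and the primitive of `g` is absolutely continuous with derivative zero
almost everywhere, hence constant. The endpoints, where a derivative within `[a,b]` is only
one-sided, form a null set. -/
theorem AbsolutelyContinuousOnInterval.eq_add_integral [CompleteSpace E] (hab : a < b)
    {y g : ℝ → E} (hy : AbsolutelyContinuousOnInterval y a b)
    (hg : IntervalIntegrable g volume a b)
    (h : ∀ᵐ t ∂(volume.restrict (Icc a b)), HasDerivWithinAt y (g t) (Icc a b) t)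
    {t : ℝ} (ht : t ∈ Icc a b) : y t = y a + ∫ s in a..t, g s := by
  have h0 : ∀ᵐ t, t ∈ uIcc a b → HasDerivAt (y - fun t => ∫ s in a..t, g s) 0 t := by
    rw [uIcc_of_le hab.le, ← ae_restrict_iff' measurableSet_Icc]
    filter_upwards [h, ae_hasDerivAt_integral_restrict_Icc hab.le hg, ae_mem_Ioo_restrict_Icc a b]
      with t h1 h2 h3
    simpa using (h1.hasDerivAt (Icc_mem_nhds h3.1 h3.2)).sub h2
  obtain ⟨C, hC⟩ := (hy.sub (absolutelyContinuousOnInterval_integral hab.le hg)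
    ).const_of_ae_hasDerivAt_zero h0
  rw [uIcc_of_le hab.le] at hC
  have h1 := hC t ht
  have h2 := hC a (left_mem_Icc.2 hab.le)
  simp only [Pi.sub_apply, intervalIntegral.integral_same, sub_zero] at h1 h2
  rw [h2, ← h1]
  abel

end AbsoluteContinuity

/-! ### Primitives and products of Sobolev functions. -/

namespace IsSobolev

variable {E : Type*} [NormedAddCommGroup E] [NormedSpace ℝ E] [FiniteDimensional ℝ E]
  {F : Type*} [NormedAddCommGroup F] [NormedSpace ℝ F] [FiniteDimensional ℝ F]
  {G : Type*} [NormedAddCommGroup G] [NormedSpace ℝ G] [FiniteDimensional ℝ G]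
  {N : ℕ} {p : ℝ≥0∞} {a b : ℝ} {y z g : ℝ → E} {v : E}

theorem memLp (hab : a < b) (h : IsSobolev N p a b y) :
    MemLp y p (volume.restrict (Icc a b)) :=
  of_add (N := 0) hab N (by rwa [zero_add])

theorem of_le (hab : a < b) {M : ℕ} (hMN : M ≤ N) (h : IsSobolev N p a b y) :
    IsSobolev M p a b y := by
  obtain ⟨k, rfl⟩ := Nat.exists_eq_add_of_le hMN
  exact h.of_add hab k

theorem intervalIntegrable (hp : 1 ≤ p) (hab : a < b) (h : IsSobolev N p a b y) :
    IntervalIntegrable y volume a b :=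
  intervalIntegrable_of_memLp_Icc hp hab.le (h.memLp hab)

theorem eq_add_integral (hp : 1 ≤ p) (hab : a < b) (h : IsSobolev (N + 1) p a b y) {t : ℝ}
    (ht : t ∈ Icc a b) : y t = y a + ∫ s in a..t, derivWithin y (Icc a b) s := by
  have : CompleteSpace E := FiniteDimensional.complete ℝ E
  refine AbsolutelyContinuousOnInterval.eq_add_integral hab
    (one_iff.1 (h.of_le hab (Nat.le_add_left 1 N))).2.1
    ((h.derivWithin_of_succ hab).intervalIntegrable hp hab) ?_ ht
  filter_upwards [ae_differentiableWithinAt hab h] with t h1 using h1.hasDerivWithinAt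

theorem ae_derivWithin_of_integral (hab : a < b) (hg : IntervalIntegrable g volume a b)
    (hy : ∀ t ∈ Icc a b, y t = v + ∫ s in a..t, g s) :
    derivWithin y (Icc a b) =ᵐ[volume.restrict (Icc a b)] g := by
  have : CompleteSpace E := FiniteDimensional.complete ℝ E
  filter_upwards [ae_hasDerivAt_integral_restrict_Icc hab.le hg,
    ae_restrict_mem measurableSet_Icc] with t h1 h2
  exact ((h1.const_add v).hasDerivWithinAt.congr hy (hy t h2)).derivWithin
    (uniqueDiffOn_Icc hab t h2)

theorem hasDerivWithinAt_of_integral (hab : a < b) (hg : ContinuousOn g (Icc a b))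
    (hy : ∀ t ∈ Icc a b, y t = v + ∫ s in a..t, g s) {t : ℝ} (ht : t ∈ Icc a b) :
    HasDerivWithinAt y (g t) (Icc a b) t := by
  have : CompleteSpace E := FiniteDimensional.complete ℝ E
  -- Extending `g` by its endpoint values makes it continuous on all of `ℝ`, so the fundamental
  -- theorem applies at the endpoints too.
  have hc : Continuous (IccExtend hab.le ((Icc a b).domRestrict g)) :=
    (continuousOn_iff_continuous_domRestrict.1 hg).Icc_extend'
  have he : ∀ s ∈ Icc a b, IccExtend hab.le ((Icc a b).domRestrict g) s = g s := fun s hs => by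
    rw [IccExtend_of_mem _ _ hs, domRestrict_apply]
  have h1 := (hc.integral_hasStrictDerivAt a t).hasDerivAt.hasDerivWithinAt (s := Icc a b)
  rw [he t ht] at h1
  have h2 : ∀ s ∈ Icc a b, y s = v + ∫ s in a..s, IccExtend hab.le ((Icc a b).domRestrict g) s := by
    intro s hs
    rw [hy s hs]
    congr 1
    refine intervalIntegral.integral_congr fun u hu => ?_
    rw [uIcc_of_le hs.1] at hu
    exact (he u ⟨hu.1, hu.2.trans hs.2⟩).symm
  exact (h1.const_add v).congr h2 (h2 t ht)

theorem derivWithin_of_integral (hab : a < b) (hg : ContinuousOn g (Icc a b))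
    (hy : ∀ t ∈ Icc a b, y t = v + ∫ s in a..t, g s) :
    EqOn (derivWithin y (Icc a b)) g (Icc a b) := fun t ht =>
  (hasDerivWithinAt_of_integral hab hg hy ht).derivWithin (uniqueDiffOn_Icc hab t ht)

/-- Integration gains one order; all regularity of solutions comes from this. For `N = 0` the
derivative is recovered only almost everywhere and absolute continuity comes from the integral; for
`N ≥ 1` the integrand is continuous and the derivative exists everywhere. -/
theorem of_integral (hp : 1 ≤ p) (hab : a < b) (hg : IsSobolev N p a b g)
    (hy : ∀ t ∈ Icc a b, y t = v + ∫ s in a..t, g s) : IsSobolev (N + 1) p a b y := by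
  have hi := hg.intervalIntegrable hp hab
  cases N with
  | zero =>
    have hac : AbsolutelyContinuousOnInterval y a b := by
      have h1 := (LipschitzWith.const (α := ℝ) v).lipschitzOnWith (s := uIcc a b)
      refine ac_congr hab (h1.absolutelyContinuousOnInterval.add
        (absolutelyContinuousOnInterval_integral hab.le hi)) fun t ht => (hy t ht).symm
    refine one_iff.2 ⟨?_, hac, (memLp_congr_ae (ae_derivWithin_of_integral hab hi hy)).2 hg⟩
    simpa [uIcc_of_le hab.le] using hac.continuousOn
  | succ N =>
    refine (add_two_iff hab).2 ⟨fun t ht =>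
      (hasDerivWithinAt_of_integral hab hg.continuousOn hy ht).differentiableWithinAt, ?_⟩
    exact hg.congr hab (derivWithin_of_integral hab hg.continuousOn hy).symm

theorem of_hasDerivWithinAt (hab : a < b) (hg : IsSobolev (N + 1) p a b g)
    (hy : ∀ t ∈ Icc a b, HasDerivWithinAt y (g t) (Icc a b) t) : IsSobolev (N + 2) p a b y :=
  (add_two_iff hab).2 ⟨fun t ht => (hy t ht).differentiableWithinAt,
    hg.congr hab fun t ht => ((hy t ht).derivWithin (uniqueDiffOn_Icc hab t ht)).symm⟩

theorem ae_derivWithin_bilin (hab : a < b) (L : E →L[ℝ] F →L[ℝ] G) {f : ℝ → E} {g : ℝ → F}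
    (hf : IsSobolev (N + 1) p a b f) (hg : IsSobolev (N + 1) p a b g) :
    derivWithin (fun t => L (f t) (g t)) (Icc a b) =ᵐ[volume.restrict (Icc a b)]
      (fun t => L (derivWithin f (Icc a b) t) (g t)) +
        fun t => L (f t) (derivWithin g (Icc a b) t) := by
  filter_upwards [ae_differentiableWithinAt hab hf, ae_differentiableWithinAt hab hg] with t h1 h2
  rw [L.derivWithin_of_bilinear h1 h2, Pi.add_apply, add_comm]

/-- Each Leibniz term differentiates only one factor, so the other keeps the extra order that
`bilin` requires; the second term uses `L.flip`. -/
theorem derivWithin_bilin_sobolev (hab : a < b) (L : E →L[ℝ] F →L[ℝ] G) {f : ℝ → E} {g : ℝ → F}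
    (hf : IsSobolev (N + 1) p a b f) (hg : IsSobolev (N + 1) p a b g) :
    IsSobolev N p a b ((fun t => L (derivWithin f (Icc a b) t) (g t)) +
        fun t => L (f t) (derivWithin g (Icc a b) t)) :=
  (bilin hab L (hf.derivWithin_of_succ hab) hg).add hab
    (bilin hab L.flip (hg.derivWithin_of_succ hab) hf)

/-- For `N ≥ 1` the product of two functions of class `W_p^N` is of class `W_p^N`. -/
theorem bilin_succ (hab : a < b) (L : E →L[ℝ] F →L[ℝ] G) {f : ℝ → E}
    {g : ℝ → F} (hf : IsSobolev (N + 1) p a b f) (hg : IsSobolev (N + 1) p a b g) :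
    IsSobolev (N + 1) p a b (fun t => L (f t) (g t)) := by
  have hd := derivWithin_bilin_sobolev hab L hf hg
  cases N with
  | zero =>
    have h1 := one_iff.1 hf
    have h2 := one_iff.1 hg
    exact one_iff.2 ⟨L.continuous₂.comp_continuousOn (h1.1.prodMk h2.1), ac_bilin L h1.2.1 h2.2.1,
      (memLp_congr_ae (ae_derivWithin_bilin hab L hf hg)).2 hd⟩
  | succ N =>
    refine of_hasDerivWithinAt hab hd fun t ht => ?_
    have h1 := ((add_two_iff hab).1 hf).1 t ht
    have h2 := ((add_two_iff hab).1 hg).1 t ht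
    rw [Pi.add_apply, add_comm]
    exact L.hasDerivWithinAt_of_bilinear h1.hasDerivWithinAt h2.hasDerivWithinAt

theorem const (hab : a < b) (v : E) : IsSobolev N p a b fun _ => v := by
  have h0 : ∀ k, IsSobolev (k + 1) p a b fun _ => v := by
    intro k
    induction k generalizing v with
    | zero =>
      refine one_iff.2 ⟨continuousOn_const,
        (LipschitzWith.const (α := ℝ) v).lipschitzOnWith.absolutelyContinuousOnInterval, ?_⟩
      simp
    | succ k ih =>
      refine of_hasDerivWithinAt hab (ih 0) fun t _ => hasDerivWithinAt_const t _ v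
  exact (h0 N).of_succ hab

theorem clm_comp (hab : a < b) (L : E →L[ℝ] F) (hy : IsSobolev N p a b y) :
    IsSobolev N p a b fun t => L (y t) :=
  bilin hab (ContinuousLinearMap.apply ℝ F (E := E)) hy
    (const hab L : IsSobolev (N + 1) p a b fun _ => L)

theorem sum (hab : a < b) {ι : Type*} (s : Finset ι) {f : ι → ℝ → E}
    (h : ∀ i ∈ s, IsSobolev N p a b (f i)) : IsSobolev N p a b fun t => ∑ i ∈ s, f i t := by
  classical
  induction s using Finset.induction_on with
  | empty => simpa using const hab (0 : E)
  | insert i s hi ih =>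
    simp only [Finset.sum_insert hi]
    exact (h i (Finset.mem_insert_self i s)).add hab
      (ih fun j hj => h j (Finset.mem_insert_of_mem hj))

end IsSobolev

/-! ### Norm estimates and the embedding into continuous functions. -/

section SobolevNorm

variable {E : Type*} [NormedAddCommGroup E] [NormedSpace ℝ E]
  {N : ℕ} {p : ℝ≥0∞} {a b : ℝ} {y z g : ℝ → E}

/-- The `L_p` norm on `[a,b]`. -/
def lpNormIcc (p : ℝ≥0∞) (a b : ℝ) (y : ℝ → E) : ℝ :=
  (eLpNorm y p (volume.restrict (Icc a b))).toReal

/-- The Sobolev norm `∑_{k=0}^N ‖y^(k)‖_p` of a function. -/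
def sobolevNorm (N : ℕ) (p : ℝ≥0∞) (a b : ℝ) (y : ℝ → E) : ℝ :=
  ∑ k ∈ Finset.range (N + 1), lpNormIcc p a b (iteratedDerivWithin k y (Icc a b))

theorem lpNormIcc_nonneg : 0 ≤ lpNormIcc p a b y := ENNReal.toReal_nonneg

theorem sobolevNorm_nonneg : 0 ≤ sobolevNorm N p a b y :=
  Finset.sum_nonneg fun _ _ => lpNormIcc_nonneg

theorem lpNormIcc_congr_ae (h : y =ᵐ[volume.restrict (Icc a b)] z) :
    lpNormIcc p a b y = lpNormIcc p a b z := by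
  rw [lpNormIcc, lpNormIcc, eLpNorm_congr_ae h]

theorem sobolevNorm_zero : sobolevNorm 0 p a b y = lpNormIcc p a b y := by
  simp [sobolevNorm]

theorem sobolevNorm_succ : sobolevNorm (N + 1) p a b y =
    lpNormIcc p a b y + sobolevNorm N p a b (derivWithin y (Icc a b)) := by
  rw [sobolevNorm, Finset.sum_range_succ', add_comm, iteratedDerivWithin_zero, sobolevNorm]
  simp only [iteratedDerivWithin_succ']

theorem sobolevNorm_mono {M : ℕ} (h : M ≤ N) : sobolevNorm M p a b y ≤ sobolevNorm N p a b y :=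
  Finset.sum_le_sum_of_subset_of_nonneg (Finset.range_subset_range.2 (by omega))
    fun _ _ _ => lpNormIcc_nonneg

theorem lpNormIcc_le_sobolevNorm : lpNormIcc p a b y ≤ sobolevNorm N p a b y := by
  rw [← sobolevNorm_zero]
  exact sobolevNorm_mono (Nat.zero_le N)

theorem sobolevNorm_derivWithin_le :
    sobolevNorm N p a b (derivWithin y (Icc a b)) ≤ sobolevNorm (N + 1) p a b y := by
  rw [sobolevNorm_succ]
  exact le_add_of_nonneg_left lpNormIcc_nonneg

theorem sobolevNorm_iteratedDerivWithin_le (k : ℕ) :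
    sobolevNorm N p a b (iteratedDerivWithin k y (Icc a b)) ≤ sobolevNorm (N + k) p a b y := by
  induction k generalizing y with
  | zero => simp
  | succ k ih =>
    rw [iteratedDerivWithin_succ']
    exact ih.trans (sobolevNorm_derivWithin_le (N := N + k))

theorem sobolevNorm_congr_eqOn (h : EqOn y z (Icc a b)) :
    sobolevNorm N p a b y = sobolevNorm N p a b z :=
  Finset.sum_congr rfl fun _ _ => lpNormIcc_congr_ae
    (IsSobolev.ae_of_forall fun _ ht => iteratedDerivWithin_congr h ht)

theorem IsSobolev.eqOn_of_ae_eq (hab : a < b) (hy : IsSobolev (N + 1) p a b y)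
    (hz : IsSobolev (N + 1) p a b z) (h : y =ᵐ[volume.restrict (Icc a b)] z) :
    EqOn y z (Icc a b) :=
  Measure.eqOn_Icc_of_ae_eq volume hab.ne h hy.continuousOn hz.continuousOn

/-- Almost everywhere equality alone says nothing about pointwise derivatives; for positive order
continuity upgrades it to equality on `[a,b]`. -/
theorem sobolevNorm_congr_ae (hab : a < b) (hy : IsSobolev N p a b y) (hz : IsSobolev N p a b z)
    (h : y =ᵐ[volume.restrict (Icc a b)] z) : sobolevNorm N p a b y = sobolevNorm N p a b z := by
  cases N with
  | zero => rw [sobolevNorm_zero, sobolevNorm_zero, lpNormIcc_congr_ae h]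
  | succ N => exact sobolevNorm_congr_eqOn (hy.eqOn_of_ae_eq hab hz h)

theorem lpNormIcc_add_le (hp : 1 ≤ p) (hy : MemLp y p (volume.restrict (Icc a b)))
    (hz : MemLp z p (volume.restrict (Icc a b))) :
    lpNormIcc p a b (y + z) ≤ lpNormIcc p a b y + lpNormIcc p a b z := by
  rw [lpNormIcc, lpNormIcc, lpNormIcc, ← ENNReal.toReal_add hy.eLpNorm_ne_top hz.eLpNorm_ne_top]
  exact ENNReal.toReal_mono (ENNReal.add_ne_top.2 ⟨hy.eLpNorm_ne_top, hz.eLpNorm_ne_top⟩)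
    (eLpNorm_add_le hy.1 hz.1 hp)

theorem sobolevNorm_add_le [FiniteDimensional ℝ E] (hp : 1 ≤ p) (hab : a < b)
    (hy : IsSobolev N p a b y) (hz : IsSobolev N p a b z) :
    sobolevNorm N p a b (y + z) ≤ sobolevNorm N p a b y + sobolevNorm N p a b z := by
  simp only [sobolevNorm, ← Finset.sum_add_distrib]
  refine Finset.sum_le_sum fun k hk => ?_
  have hk : k ≤ N := by simpa [Nat.lt_succ_iff] using hk
  rw [lpNormIcc_congr_ae (IsSobolev.ae_iteratedDerivWithin_add hab hk hy hz)]
  exact lpNormIcc_add_le hp (hy.memLp_iteratedDerivWithin hab hk)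
    (hz.memLp_iteratedDerivWithin hab hk)

/-- The constant in `∫ ‖g‖ ≤ C ‖g‖_p` on `[a,b]`. -/
def holderConst (p : ℝ≥0∞) (a b : ℝ) : ℝ :=
  ((volume.restrict (Icc a b)) univ ^ (1 / (1 : ℝ≥0∞).toReal - 1 / p.toReal)).toReal

theorem holderConst_nonneg : 0 ≤ holderConst p a b := ENNReal.toReal_nonneg

theorem integral_norm_le_lpNormIcc (hp : 1 ≤ p) (hg : MemLp g p (volume.restrict (Icc a b))) :
    ∫ s in Icc a b, ‖g s‖ ≤ holderConst p a b * lpNormIcc p a b g := by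
  -- The exponent is `1 - 1/p ≥ 0`; for `p = ∞` the conventions `toReal ⊤ = 0` and `1 / 0 = 0` give
  -- exponent `1`, as they should.
  have hc : (volume.restrict (Icc a b)) univ ^ (1 / (1 : ℝ≥0∞).toReal - 1 / p.toReal) ≠ ⊤ := by
    refine ENNReal.rpow_ne_top_of_nonneg ?_ (measure_ne_top _ _)
    rcases eq_or_ne p ⊤ with rfl | h
    · simp
    · have h1 : 1 ≤ p.toReal := by
        simpa using ENNReal.toReal_mono h hp
      simpa using inv_le_one_of_one_le₀ h1
  rw [integral_norm_eq_lintegral_enorm hg.1, ← eLpNorm_one_eq_lintegral_enorm, holderConst,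
    lpNormIcc, mul_comm, ← ENNReal.toReal_mul]
  exact ENNReal.toReal_mono (ENNReal.mul_ne_top hg.eLpNorm_ne_top hc)
    (eLpNorm_le_eLpNorm_mul_rpow_measure_univ hp hg.1)

theorem norm_integral_le_lpNormIcc (hp : 1 ≤ p) (hg : MemLp g p (volume.restrict (Icc a b)))
    {t : ℝ} (ht : t ∈ Icc a b) :
    ‖∫ s in a..t, g s‖ ≤ holderConst p a b * lpNormIcc p a b g := by
  refine (intervalIntegral.norm_integral_le_integral_norm ht.1).trans
    (le_trans ?_ (integral_norm_le_lpNormIcc hp hg))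
  rw [intervalIntegral.integral_of_le ht.1]
  exact setIntegral_mono_set (hg.integrable hp).norm (Eventually.of_forall fun _ => norm_nonneg _)
    (Ioc_subset_Icc_self.trans (Icc_subset_Icc_right ht.2)).eventuallyLE

theorem lpNormIcc_le_of_bound {M : ℝ} (h : ∀ t ∈ Icc a b, ‖y t‖ ≤ M) (hM : 0 ≤ M) :
    lpNormIcc p a b y ≤ ((volume.restrict (Icc a b)) univ ^ p.toReal⁻¹).toReal * M := by
  have hc : (volume.restrict (Icc a b)) univ ^ p.toReal⁻¹ ≠ ⊤ :=
    ENNReal.rpow_ne_top_of_nonneg (by positivity) (measure_ne_top _ _)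
  have e : ((volume.restrict (Icc a b)) univ ^ p.toReal⁻¹).toReal * M =
      ((volume.restrict (Icc a b)) univ ^ p.toReal⁻¹ * ENNReal.ofReal M).toReal := by
    rw [ENNReal.toReal_mul, ENNReal.toReal_ofReal hM]
  rw [lpNormIcc, e]
  exact ENNReal.toReal_mono (ENNReal.mul_ne_top hc ENNReal.ofReal_ne_top)
    (eLpNorm_le_of_ae_bound (IsSobolev.ae_of_forall h))

/-- The constant of the embedding of `W_p^1` in the continuous functions. -/
def embeddingConst (p : ℝ≥0∞) (a b : ℝ) : ℝ :=
  holderConst p a b * ((b - a)⁻¹ + 2)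

theorem embeddingConst_nonneg (hab : a < b) : 0 ≤ embeddingConst p a b :=
  mul_nonneg holderConst_nonneg (add_nonneg (inv_nonneg.2 (sub_nonneg.2 hab.le)) zero_le_two)

/-- Any value differs from `y a` by at most `H * d`. Averaging `‖y a‖ ≤ ‖y s‖ + H * d` over `s`
bounds `‖y a‖` by the `L_p` norms, and a second use of the increment bound reaches `y t`; hence the
terms `(b - a)⁻¹` and `2` in the constant. -/
theorem norm_le_sobolevNorm_one [FiniteDimensional ℝ E] (hp : 1 ≤ p) (hab : a < b)
    (hy : IsSobolev 1 p a b y) {t : ℝ} (ht : t ∈ Icc a b) :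
    ‖y t‖ ≤ embeddingConst p a b * sobolevNorm 1 p a b y := by
  set H := holderConst p a b with hH
  set d := lpNormIcc p a b (derivWithin y (Icc a b)) with hd
  have hy' := hy.derivWithin_of_succ hab
  have hH0 : 0 ≤ H := holderConst_nonneg
  have hd0 : 0 ≤ d := lpNormIcc_nonneg
  have h1 : ∀ s ∈ Icc a b, ‖y s - y a‖ ≤ H * d := fun s hs => by
    rw [hy.eq_add_integral (N := 0) hp hab hs, add_sub_cancel_left]
    exact norm_integral_le_lpNormIcc hp hy' hs
  have h2 : ∀ s ∈ Icc a b, ‖y a‖ ≤ ‖y s‖ + H * d := fun s hs => by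
    have := norm_sub_norm_le (y a) (y s)
    rw [norm_sub_rev] at this
    linarith [h1 s hs]
  have hi : IntegrableOn (fun s => ‖y s‖) (Icc a b) := ((hy.memLp hab).integrable hp).norm
  have h3 : ∫ s in Icc a b, (‖y a‖ - H * d) ≤ ∫ s in Icc a b, ‖y s‖ :=
    setIntegral_mono_on (integrable_const _) hi measurableSet_Icc
      fun s hs => by linarith [h2 s hs]
  rw [setIntegral_const, measureReal_def, Real.volume_Icc,
    ENNReal.toReal_ofReal (sub_nonneg.2 hab.le), smul_eq_mul] at h3
  have h4 := h3.trans (integral_norm_le_lpNormIcc hp (hy.memLp hab))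
  have hba : 0 < b - a := sub_pos.2 hab
  have h5 : ‖y a‖ - H * d ≤ (b - a)⁻¹ * (H * lpNormIcc p a b y) := by
    rw [inv_mul_eq_div, le_div_iff₀ hba, mul_comm]
    exact h4
  have h6 : ‖y t‖ ≤ ‖y a‖ + H * d := by
    have := norm_sub_norm_le (y t) (y a)
    linarith [h1 t ht]
  rw [embeddingConst, sobolevNorm_succ, sobolevNorm_zero, ← hH, ← hd]
  have h7 : 0 ≤ lpNormIcc p a b y := lpNormIcc_nonneg
  have h8 : 0 ≤ (b - a)⁻¹ * (H * d) := by positivity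
  have h9 : 0 ≤ H * lpNormIcc p a b y := by positivity
  nlinarith

theorem norm_le_sobolevNorm [FiniteDimensional ℝ E] (hp : 1 ≤ p) (hab : a < b)
    (hy : IsSobolev (N + 1) p a b y) {t : ℝ} (ht : t ∈ Icc a b) :
    ‖y t‖ ≤ embeddingConst p a b * sobolevNorm (N + 1) p a b y :=
  (norm_le_sobolevNorm_one hp hab (hy.of_le hab (Nat.le_add_left 1 N)) ht).trans
    (mul_le_mul_of_nonneg_left (sobolevNorm_mono (Nat.le_add_left 1 N))
      (embeddingConst_nonneg hab))

/-- A function is controlled by one point value and its derivative; this turns convergence of these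
two into convergence in the next Sobolev norm. -/
theorem sobolevNorm_succ_le [FiniteDimensional ℝ E] (hp : 1 ≤ p) (hab : a < b)
    (hy : IsSobolev (N + 1) p a b y) : sobolevNorm (N + 1) p a b y ≤
      ((volume.restrict (Icc a b)) univ ^ p.toReal⁻¹).toReal *
        (‖y a‖ + holderConst p a b * sobolevNorm N p a b (derivWithin y (Icc a b))) +
      sobolevNorm N p a b (derivWithin y (Icc a b)) := by
  have h0 : 0 ≤ holderConst p a b * sobolevNorm N p a b (derivWithin y (Icc a b)) :=
    mul_nonneg holderConst_nonneg sobolevNorm_nonneg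
  rw [sobolevNorm_succ]
  gcongr
  refine lpNormIcc_le_of_bound (fun t ht => ?_) (by positivity)
  rw [hy.eq_add_integral hp hab ht]
  refine norm_add_le_of_le le_rfl ((norm_integral_le_lpNormIcc hp
    ((hy.derivWithin_of_succ hab).memLp hab) ht).trans ?_)
  exact mul_le_mul_of_nonneg_left lpNormIcc_le_sobolevNorm holderConst_nonneg

theorem IsSobolev.ae_derivWithin_sub [FiniteDimensional ℝ E] (hab : a < b)
    (hy : IsSobolev (N + 1) p a b y) (hz : IsSobolev (N + 1) p a b z) :
    derivWithin (y - z) (Icc a b) =ᵐ[volume.restrict (Icc a b)]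
      derivWithin y (Icc a b) - derivWithin z (Icc a b) := by
  filter_upwards [ae_differentiableWithinAt hab hy, ae_differentiableWithinAt hab hz] with t h1 h2
  exact derivWithin_sub h1 h2

theorem sobolevNorm_eq_zero_of_ae (hab : a < b) (hy : IsSobolev N p a b y)
    (h : ∀ᵐ t ∂(volume.restrict (Icc a b)), y t = 0) : sobolevNorm N p a b y = 0 := by
  have e : ∀ k, iteratedDerivWithin k (0 : ℝ → E) (Icc a b) = 0 := fun k => by
    ext t; exact iteratedDerivWithin_const_zero
  have h0 : sobolevNorm N p a b (0 : ℝ → E) = 0 := by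
    simp [sobolevNorm, e, lpNormIcc]
  rw [← h0]
  cases N with
  | zero => rw [sobolevNorm_zero, sobolevNorm_zero]; exact lpNormIcc_congr_ae h
  | succ N =>
    exact sobolevNorm_congr_eqOn
      (Measure.eqOn_Icc_of_ae_eq volume hab.ne h hy.continuousOn continuousOn_const)

theorem ae_eq_zero_of_sobolevNorm [FiniteDimensional ℝ E] (hp : 1 ≤ p) (hab : a < b) (hy : IsSobolev N p a b y)
    (h : sobolevNorm N p a b y = 0) : ∀ᵐ t ∂(volume.restrict (Icc a b)), y t = 0 := by
  have h1 : lpNormIcc p a b y = 0 :=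
    le_antisymm (h ▸ lpNormIcc_le_sobolevNorm) lpNormIcc_nonneg
  have hm := hy.memLp hab
  rw [lpNormIcc, ENNReal.toReal_eq_zero_iff, or_iff_left hm.eLpNorm_ne_top,
    eLpNorm_eq_zero_iff hm.1 (by positivity)] at h1
  exact h1

end SobolevNorm

/-! ### Completeness of the Sobolev spaces. -/

namespace SobolevSpace

variable {E : Type*} [NormedAddCommGroup E] [NormedSpace ℂ E] [FiniteDimensional ℝ E]
  {a b : ℝ} {hab : a < b} {N : ℕ} {p : ℝ≥0∞}

theorem norm_eq_sobolevNorm (y : SobolevSpace E hab N p) : ‖y‖ = sobolevNorm N p a b y := rfl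

/-- The element of `W_p^N` given by a function of class `W_p^N`. -/
def mk (y : ℝ → E) (h : IsSobolev N p a b y) : SobolevSpace E hab N p := ⟨y, h⟩

/-- The derivative, from `W_p^{N+1}` to `W_p^N`. -/
def derivative (y : SobolevSpace E hab (N + 1) p) : SobolevSpace E hab N p :=
  mk _ (y.isSobolev.derivWithin_of_succ hab)

variable [hp : Fact (1 ≤ p)]

theorem norm_derivative_sub_derivative (y z : SobolevSpace E hab (N + 1) p) :
    ‖derivative y - derivative z‖ = sobolevNorm N p a b (derivWithin (y - z) (Icc a b)) :=
  sobolevNorm_congr_ae hab (derivative y - derivative z).isSobolev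
    ((y - z).isSobolev.derivWithin_of_succ hab)
    (IsSobolev.ae_derivWithin_sub hab y.isSobolev z.isSobolev).symm

/-- Passing to classes in `Lp` preserves distances, so a limit in the complete space `Lp` supplies a
representative. -/
theorem exists_tendsto_of_cauchySeq_zero (u : ℕ → SobolevSpace E hab 0 p) (hu : CauchySeq u) :
    ∃ y, Tendsto u atTop (𝓝 y) := by
  have : CompleteSpace E := FiniteDimensional.complete ℝ E
  have hm : ∀ y : SobolevSpace E hab 0 p, MemLp y p (volume.restrict (Icc a b)) :=
    fun y => y.isSobolev
  have hd : ∀ y z : SobolevSpace E hab 0 p, dist ((hm y).toLp y) ((hm z).toLp z) = dist y z := by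
    intro y z
    rw [dist_eq_norm, dist_eq_norm, ← MemLp.toLp_sub, Lp.norm_toLp, norm_eq_sobolevNorm,
      sobolevNorm_zero]
    rfl
  have hc : CauchySeq fun k => (hm (u k)).toLp (u k) := by
    rw [Metric.cauchySeq_iff] at hu ⊢
    simpa only [hd] using hu
  obtain ⟨g, hg⟩ := cauchySeq_tendsto_of_complete hc
  refine ⟨mk g (Lp.memLp g), ?_⟩
  rw [tendsto_iff_dist_tendsto_zero] at hg ⊢
  refine hg.congr fun k => ?_
  rw [← hd]
  congr 1
  exact (Lp.toLp_coeFn g (Lp.memLp g)).symm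

/-- Induction on the order: the derivatives converge to some `g`, and the values at `a` converge to
some `v` by the embedding. The limit is the primitive `v + ∫ g`. -/
theorem exists_tendsto_of_cauchySeq (u : ℕ → SobolevSpace E hab N p) (hu : CauchySeq u) :
    ∃ y, Tendsto u atTop (𝓝 y) := by
  induction N with
  | zero => exact exists_tendsto_of_cauchySeq_zero u hu
  | succ N ih =>
    have : CompleteSpace E := FiniteDimensional.complete ℝ E
    have h1 : LipschitzWith 1 (derivative : SobolevSpace E hab (N + 1) p → _) := by
      refine LipschitzWith.of_dist_le_mul fun y z => ?_
      rw [dist_eq_norm, dist_eq_norm, norm_derivative_sub_derivative, NNReal.coe_one, one_mul]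
      exact sobolevNorm_derivWithin_le
    have h2 : LipschitzWith ⟨_, embeddingConst_nonneg (p := p) hab⟩
        (fun y : SobolevSpace E hab (N + 1) p => y a) := by
      refine LipschitzWith.of_dist_le_mul fun y z => ?_
      rw [dist_eq_norm, dist_eq_norm]
      exact norm_le_sobolevNorm hp.out hab (y - z).isSobolev (left_mem_Icc.2 hab.le)
    obtain ⟨g, hg⟩ := ih _ (h1.uniformContinuous.comp_cauchySeq hu)
    have h3 : CauchySeq fun k => u k a :=
      h2.uniformContinuous.comp_cauchySeq hu
    obtain ⟨v, hv⟩ := cauchySeq_tendsto_of_complete h3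
    have hy := IsSobolev.of_integral (v := v) hp.out hab g.isSobolev fun t _ => rfl
    refine ⟨mk _ hy, ?_⟩
    rw [tendsto_iff_norm_sub_tendsto_zero] at hg hv ⊢
    refine squeeze_zero (fun _ => norm_nonneg _) (fun k => ?_)
      (by simpa using ((hv.add (hg.const_mul (holderConst p a b))).const_mul
        ((volume.restrict (Icc a b)) univ ^ p.toReal⁻¹).toReal).add hg)
    refine (sobolevNorm_succ_le hp.out hab (u k - mk _ hy).isSobolev).trans_eq ?_
    have e : sobolevNorm N p a b (derivWithin (u k - mk _ hy : SobolevSpace E hab (N + 1) p)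
        (Icc a b)) = ‖derivative (u k) - g‖ := by
      refine sobolevNorm_congr_ae hab ((u k - mk _ hy).isSobolev.derivWithin_of_succ hab)
        (derivative (u k) - g).isSobolev ?_
      filter_upwards [IsSobolev.ae_derivWithin_sub hab (u k).isSobolev hy,
        IsSobolev.ae_derivWithin_of_integral hab (g.isSobolev.intervalIntegrable hp.out hab)
          (y := mk (hab := hab) _ hy) (fun t _ => rfl)] with t h3 h4
      exact h3.trans (congrArg (derivWithin (u k) (Icc a b) t - ·) h4)
    have e' : (u k - mk _ hy : SobolevSpace E hab (N + 1) p) a = u k a - v := by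
      change u k a - (v + ∫ s in a..a, g s) = _
      rw [intervalIntegral.integral_same, add_zero]
    simp [e, e']

instance : CompleteSpace (SobolevSpace E hab N p) :=
  Metric.complete_of_cauchySeq_tendsto exists_tendsto_of_cauchySeq

end SobolevSpace

/-! ### Multiplication estimates. -/

section Product

variable {E F G : Type*} [NormedAddCommGroup E] [NormedSpace ℝ E] [FiniteDimensional ℝ E]
  [NormedAddCommGroup F] [NormedSpace ℝ F] [FiniteDimensional ℝ F]
  [NormedAddCommGroup G] [NormedSpace ℝ G] [FiniteDimensional ℝ G]
  {N : ℕ} {p : ℝ≥0∞} {a b : ℝ}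

/-- The smoother factor is bounded uniformly by the embedding, and the other is left in `L_p`. -/
theorem lpNormIcc_bilin_le (hp : 1 ≤ p) (hab : a < b) (L : E →L[ℝ] F →L[ℝ] G) {f : ℝ → E}
    {g : ℝ → F} (hf : MemLp f p (volume.restrict (Icc a b))) (hg : IsSobolev (N + 1) p a b g) :
    lpNormIcc p a b (fun t => L (f t) (g t)) ≤
      ‖L‖ * embeddingConst p a b * lpNormIcc p a b f * sobolevNorm (N + 1) p a b g := by
  set M := embeddingConst p a b * sobolevNorm (N + 1) p a b g with hM
  have hM0 : 0 ≤ M := mul_nonneg (embeddingConst_nonneg hab) sobolevNorm_nonneg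
  have h1 : ∀ᵐ t ∂(volume.restrict (Icc a b)), ‖L (f t) (g t)‖ ≤ ‖L‖ * M * ‖f t‖ :=
    IsSobolev.ae_of_forall fun t ht => by
      have h2 := norm_le_sobolevNorm hp hab hg ht
      calc ‖L (f t) (g t)‖ ≤ ‖L‖ * ‖f t‖ * ‖g t‖ := L.le_opNorm₂ _ _
        _ ≤ ‖L‖ * ‖f t‖ * M := by gcongr
        _ = ‖L‖ * M * ‖f t‖ := by ring
  have h3 := eLpNorm_le_mul_eLpNorm_of_ae_le_mul h1 p
  have h4 := ENNReal.toReal_mono (ENNReal.mul_ne_top ENNReal.ofReal_ne_top hf.eLpNorm_ne_top) h3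
  rw [ENNReal.toReal_mul, ENNReal.toReal_ofReal (by positivity)] at h4
  refine h4.trans_eq ?_
  rw [hM, lpNormIcc]
  ring

/-- Induction on `N` by the Leibniz rule. The extra order of `g` gives a uniform bound even for `N =
0`; it is available in the application, since `y^(j)` with `j < r` has order at least `n + 1`. -/
theorem exists_sobolevNorm_bilin_le (hp : 1 ≤ p) (hab : a < b) (L : E →L[ℝ] F →L[ℝ] G) (N : ℕ) :
    ∃ C, 0 ≤ C ∧ ∀ (f : ℝ → E) (g : ℝ → F), IsSobolev N p a b f → IsSobolev (N + 1) p a b g →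
      sobolevNorm N p a b (fun t => L (f t) (g t)) ≤
        C * (sobolevNorm N p a b f * sobolevNorm (N + 1) p a b g) := by
  have hC0 : 0 ≤ ‖L‖ * embeddingConst p a b :=
    mul_nonneg (norm_nonneg L) (embeddingConst_nonneg hab)
  induction N with
  | zero =>
    refine ⟨_, hC0, fun f g hf hg => ?_⟩
    rw [sobolevNorm_zero, sobolevNorm_zero, ← mul_assoc]
    exact lpNormIcc_bilin_le hp hab L hf hg
  | succ N ih =>
    obtain ⟨C, hC, h⟩ := ih
    refine ⟨‖L‖ * embeddingConst p a b + C + C, by positivity, fun f g hf hg => ?_⟩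
    have hg1 := hg.of_succ hab
    have hf' := hf.derivWithin_of_succ hab
    have hg' := hg.derivWithin_of_succ hab
    have e : sobolevNorm N p a b (derivWithin (fun t => L (f t) (g t)) (Icc a b)) =
        sobolevNorm N p a b ((fun t => L (derivWithin f (Icc a b) t) (g t)) +
          fun t => L (f t) (derivWithin g (Icc a b) t)) :=
      sobolevNorm_congr_ae hab ((hf.bilin_succ hab L hg1).derivWithin_of_succ hab)
        (hf.derivWithin_bilin_sobolev hab L hg1) (hf.ae_derivWithin_bilin hab L hg1)
    have h1 := lpNormIcc_bilin_le hp hab L (hf.memLp hab) hg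
    have h2 := sobolevNorm_add_le hp hab (hf'.bilin hab L hg1)
      ((hf.of_succ hab).bilin hab L hg')
    have h3 := h _ _ hf' hg1
    have h4 := h _ _ (hf.of_succ hab) hg'
    have h5 : ∀ M x, 0 ≤ M → x ≤ sobolevNorm (N + 1) p a b f → ∀ y ≤
        sobolevNorm (N + 1 + 1) p a b g, 0 ≤ y → M * (x * y) ≤
        M * (sobolevNorm (N + 1) p a b f * sobolevNorm (N + 1 + 1) p a b g) := by
      intro M x hM hx y hy hy0
      gcongr
      exact sobolevNorm_nonneg
    rw [mul_assoc] at h1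
    have h1' := h1.trans (h5 _ _ hC0 lpNormIcc_le_sobolevNorm _ le_rfl sobolevNorm_nonneg)
    have h3' := h3.trans (h5 _ _ hC sobolevNorm_derivWithin_le _
      (sobolevNorm_mono (Nat.le_succ _)) sobolevNorm_nonneg)
    have h4' := h4.trans (h5 _ _ hC (sobolevNorm_mono (Nat.le_succ _)) _
      sobolevNorm_derivWithin_le sobolevNorm_nonneg)
    rw [sobolevNorm_succ, e]
    linarith

end Product

/-! ### Which Sobolev functions are identified by the seminorm. -/

namespace SobolevSpace

variable {E : Type*} [NormedAddCommGroup E] [NormedSpace ℂ E] [FiniteDimensional ℝ E]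
  {a b : ℝ} {hab : a < b} {N : ℕ} {p : ℝ≥0∞}

/-- The inclusion of the Sobolev space in the space of all functions, as a linear map. -/
def coeLinear : SobolevSpace E hab N p →ₗ[ℂ] ℝ → E := (sobolevSubmodule E hab N p).subtype

theorem ext {y z : SobolevSpace E hab N p} (h : ∀ t, y t = z t) : y = z := Subtype.ext (funext h)

theorem sum_apply {ι : Type*} (s : Finset ι) (f : ι → SobolevSpace E hab N p) (t : ℝ) :
    (∑ i ∈ s, f i) t = ∑ i ∈ s, f i t := by
  have := congrFun (map_sum (coeLinear (hab := hab)) f s) t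
  rwa [Finset.sum_apply] at this

variable [hp : Fact (1 ≤ p)]

theorem norm_sub_eq_zero_iff {y z : SobolevSpace E hab N p} :
    ‖y - z‖ = 0 ↔ y =ᵐ[volume.restrict (Icc a b)] z := by
  constructor
  · intro h
    filter_upwards [ae_eq_zero_of_sobolevNorm hp.out hab (y - z).isSobolev h] with t ht
    exact sub_eq_zero.1 ht
  · intro h
    refine sobolevNorm_eq_zero_of_ae hab (y - z).isSobolev ?_
    filter_upwards [h] with t ht
    exact sub_eq_zero.2 ht

theorem mk_eq_mk_iff_norm {y z : SobolevSpace E hab N p} :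
    SeparationQuotient.mk y = SeparationQuotient.mk z ↔ ‖y - z‖ = 0 := by
  rw [SeparationQuotient.mk_eq_mk, Metric.inseparable_iff, dist_eq_norm]

theorem mk_eq_mk_iff_ae {y z : SobolevSpace E hab N p} :
    SeparationQuotient.mk y = SeparationQuotient.mk z ↔ y =ᵐ[volume.restrict (Icc a b)] z :=
  mk_eq_mk_iff_norm.trans norm_sub_eq_zero_iff

theorem mk_eq_mk_iff_eqOn {y z : SobolevSpace E hab (N + 1) p} :
    SeparationQuotient.mk y = SeparationQuotient.mk z ↔ EqOn y z (Icc a b) :=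
  mk_eq_mk_iff_ae.trans
    ⟨y.isSobolev.eqOn_of_ae_eq hab z.isSobolev, fun h => IsSobolev.ae_of_forall h⟩

end SobolevSpace

/-! ### The differential operator as a bounded operator. -/

namespace BVP

variable {m n r : ℕ} {a b : ℝ} {hab : a < b} {p : ℝ≥0∞}

/-- The `r`-th derivative, from `W_p^{n+r}` to `W_p^n`. -/
def topDeriv (y : SobolevSpace (Vec m) hab (n + r) p) : SobolevSpace (Vec m) hab n p :=
  SobolevSpace.mk (y.deriv r) (y.isSobolev.iteratedDerivWithin_of_add hab r)

theorem isSobolev_deriv (y : SobolevSpace (Vec m) hab (n + r) p) (j : Fin r) :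
    IsSobolev (n + 1) p a b (y.deriv j) := by
  have h : IsSobolev (n + 1 + j) p a b y := y.isSobolev.of_le hab (by omega)
  exact h.iteratedDerivWithin_of_add hab j

/-- The product `M y^(j)`, of class `W_p^n`. -/
def mulDeriv (M : SobolevSpace (Mat m) hab n p) (y : SobolevSpace (Vec m) hab (n + r) p)
    (j : Fin r) : SobolevSpace (Vec m) hab n p :=
  SobolevSpace.mk (fun t => mulVecL m (M t) (y.deriv j t))
    (M.isSobolev.bilin hab (mulVecL m) (isSobolev_deriv y j))

theorem diffOp_eq (A : Fin r → SobolevSpace (Mat m) hab n p)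
    (y : SobolevSpace (Vec m) hab (n + r) p) :
    diffOp A y = topDeriv y + ∑ j, mulDeriv (A j) y j := by
  refine SobolevSpace.ext fun t => ?_
  change _ = topDeriv y t + (∑ j, mulDeriv (A j) y j) t
  rw [SobolevSpace.sum_apply]
  rfl

theorem mulDeriv_sub (M M' : SobolevSpace (Mat m) hab n p)
    (y : SobolevSpace (Vec m) hab (n + r) p) (j : Fin r) :
    mulDeriv M y j - mulDeriv M' y j = mulDeriv (M - M') y j := by
  refine SobolevSpace.ext fun t => ?_
  change mulVecL m (M t) _ - mulVecL m (M' t) _ = mulVecL m (M t - M' t) _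
  rw [map_sub]
  rfl

variable [hp : Fact (1 ≤ p)]

theorem norm_topDeriv_le (y : SobolevSpace (Vec m) hab (n + r) p) : ‖topDeriv y‖ ≤ ‖y‖ :=
  sobolevNorm_iteratedDerivWithin_le r

theorem exists_norm_mulDeriv_le (m n r : ℕ) (hab : a < b) (p : ℝ≥0∞) [hp : Fact (1 ≤ p)] :
    ∃ C, 0 ≤ C ∧ ∀ (M : SobolevSpace (Mat m) hab n p) (y : SobolevSpace (Vec m) hab (n + r) p)
      (j : Fin r), ‖mulDeriv M y j‖ ≤ C * (‖M‖ * ‖y‖) := by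
  obtain ⟨C, hC, h⟩ := exists_sobolevNorm_bilin_le hp.out hab (mulVecL m) n
  refine ⟨C, hC, fun M y j => (h _ _ M.isSobolev (isSobolev_deriv y j)).trans ?_⟩
  refine mul_le_mul_of_nonneg_left (mul_le_mul_of_nonneg_left ?_ (norm_nonneg M)) hC
  exact (sobolevNorm_iteratedDerivWithin_le (N := n + 1) j).trans (sobolevNorm_mono (by omega))

/-- The leading terms cancel, because the leading coefficient is always `1`; what remains is linear
in the differences of the coefficients. This yields convergence in operator norm. -/
theorem exists_norm_diffOp_sub_le (m n r : ℕ) (hab : a < b) (p : ℝ≥0∞) [hp : Fact (1 ≤ p)] :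
    ∃ C, 0 ≤ C ∧ ∀ (A A' : Fin r → SobolevSpace (Mat m) hab n p)
      (y : SobolevSpace (Vec m) hab (n + r) p),
      ‖diffOp A y - diffOp A' y‖ ≤ C * (∑ j, ‖A j - A' j‖) * ‖y‖ := by
  obtain ⟨C, hC, h⟩ := exists_norm_mulDeriv_le m n r hab p
  refine ⟨C, hC, fun A A' y => ?_⟩
  rw [diffOp_eq, diffOp_eq, add_sub_add_left_eq_sub, ← Finset.sum_sub_distrib, Finset.mul_sum,
    Finset.sum_mul]
  refine norm_sum_le_of_le _ fun j _ => ?_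
  rw [mulDeriv_sub, mul_assoc]
  exact h _ _ _

theorem exists_norm_diffOp_le (A : Fin r → SobolevSpace (Mat m) hab n p) :
    ∃ C, ∀ y : SobolevSpace (Vec m) hab (n + r) p, ‖diffOp A y‖ ≤ C * ‖y‖ := by
  obtain ⟨C, hC, h⟩ := exists_norm_mulDeriv_le m n r hab p
  refine ⟨1 + ∑ j, C * ‖A j‖, fun y => ?_⟩
  rw [diffOp_eq, add_mul, one_mul, Finset.sum_mul]
  refine norm_add_le_of_le (norm_topDeriv_le y) (norm_sum_le_of_le _ fun j _ => ?_)
  rw [mul_assoc]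
  exact h _ _ _

/-- For `n = 0` the top derivative may fail to exist on a null set, where `derivWithin` need not be
additive. The operator is therefore linear only once its target is separated. -/
theorem diffOp_add_ae (A : Fin r → SobolevSpace (Mat m) hab n p)
    (y z : SobolevSpace (Vec m) hab (n + r) p) :
    diffOp A (y + z) =ᵐ[volume.restrict (Icc a b)]
      (diffOp A y + diffOp A z : SobolevSpace (Vec m) hab n p) := by
  have h : ∀ k : Fin (r + 1), (y + z).deriv k =ᵐ[volume.restrict (Icc a b)]
      y.deriv k + z.deriv k := fun k =>
    IsSobolev.ae_iteratedDerivWithin_add hab (by omega) y.isSobolev z.isSobolev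
  filter_upwards [ae_all_iff.2 h] with t ht
  change (y + z).deriv r t + ∑ j : Fin r, mulVecL m (A j t) ((y + z).deriv j t) =
    (y.deriv r t + ∑ j : Fin r, mulVecL m (A j t) (y.deriv j t)) +
    (z.deriv r t + ∑ j : Fin r, mulVecL m (A j t) (z.deriv j t))
  have h1 : ∀ j : Fin r, (y + z).deriv j t = y.deriv j t + z.deriv j t := fun j => ht j.castSucc
  have h2 : (y + z).deriv r t = y.deriv r t + z.deriv r t := by simpa using ht (Fin.last r)
  simp only [h1, h2, map_add, Finset.sum_add_distrib]
  abel

theorem diffOp_smul (A : Fin r → SobolevSpace (Mat m) hab n p) (c : ℂ)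
    (y : SobolevSpace (Vec m) hab (n + r) p) : diffOp A (c • y) = c • diffOp A y := by
  refine SobolevSpace.ext fun t => ?_
  have h : ∀ k, (c • y).deriv k t = c • y.deriv k t := fun k =>
    congrFun (IsSobolev.iteratedDerivWithin_smul c k) t
  change (c • y).deriv r t + ∑ j : Fin r, WithLp.toLp 2 ((A j t).mulVec ((c • y).deriv j t).ofLp) =
    c • (y.deriv r t + ∑ j : Fin r, WithLp.toLp 2 ((A j t).mulVec (y.deriv j t).ofLp))
  simp only [h, smul_add, Finset.smul_sum, WithLp.ofLp_smul, Matrix.mulVec_smul, WithLp.toLp_smul]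

/-- The differential operator as a continuous linear map to the separated space. -/
def diffOpCLM (A : Fin r → SobolevSpace (Mat m) hab n p) :
    SobolevSpace (Vec m) hab (n + r) p →L[ℂ] SeparationQuotient (SobolevSpace (Vec m) hab n p) :=
  LinearMap.mkContinuousOfExistsBound
    { toFun := fun y => SeparationQuotient.mk (diffOp A y)
      map_add' := fun y z => SobolevSpace.mk_eq_mk_iff_ae.2 (diffOp_add_ae A y z)
      map_smul' := fun c y => by rw [diffOp_smul]; rfl }
    (exists_norm_diffOp_le A)

theorem diffOpCLM_apply (A : Fin r → SobolevSpace (Mat m) hab n p)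
    (y : SobolevSpace (Vec m) hab (n + r) p) :
    diffOpCLM A y = SeparationQuotient.mk (diffOp A y) := rfl

theorem tendsto_diffOpCLM {ι : Type*} {l : Filter ι}
    {A : ι → Fin r → SobolevSpace (Mat m) hab n p} {A₀ : Fin r → SobolevSpace (Mat m) hab n p}
    (h : ∀ j, Tendsto (fun i => A i j) l (𝓝 (A₀ j))) :
    Tendsto (fun i => diffOpCLM (A i)) l (𝓝 (diffOpCLM A₀)) := by
  obtain ⟨C, hC, hd⟩ := exists_norm_diffOp_sub_le m n r hab p
  rw [tendsto_iff_norm_sub_tendsto_zero]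
  refine squeeze_zero (fun _ => norm_nonneg _) (g := fun i => C * ∑ j, ‖A i j - A₀ j‖)
    (fun i => ?_) ?_
  · refine ContinuousLinearMap.opNorm_le_bound _ (by positivity) fun y => ?_
    exact hd (A i) A₀ y
  · have h1 := tendsto_finsetSum (Finset.univ : Finset (Fin r)) fun j _ =>
      (tendsto_iff_norm_sub_tendsto_zero.1 (h j))
    simpa using h1.const_mul C

/-- For `n = 0` the endpoints are null; for `n ≥ 1` continuity makes almost everywhere and pointwise
equality the same. -/
theorem eqOnInterval_iff {g h : SobolevSpace (Vec m) hab n p} :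
    EqOnInterval g h ↔ SeparationQuotient.mk g = SeparationQuotient.mk h := by
  rw [SobolevSpace.mk_eq_mk_iff_ae, EqOnInterval]
  cases n with
  | zero => rw [if_pos rfl, restrict_Ioo_eq_restrict_Icc]; rfl
  | succ n =>
    rw [if_neg n.succ_ne_zero]
    constructor
    · intro H
      filter_upwards [ae_mem_Ioo_restrict_Icc a b] with t ht using H t ht
    · intro H t ht
      exact g.isSobolev.eqOn_of_ae_eq hab h.isSobolev H (Ioo_subset_Icc_self ht)

end BVP

/-! ### Perturbation of bijective operators under strong convergence of a finite-dimensional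
component. -/

section Perturbation

variable {X Y F : Type*} [NormedAddCommGroup X] [NormedSpace ℂ X]
  [NormedAddCommGroup Y] [NormedSpace ℂ Y] [NormedAddCommGroup F] [NormedSpace ℂ F]

/-- Convergence along a filter does not bound a whole family, so Banach–Steinhaus needs sequences.
If no bound held eventually, countable generation would give a sequence along `l` with norms
exceeding `k`, although it is pointwise bounded. -/
theorem eventually_norm_le_of_tendsto_apply [CompleteSpace X] {ι : Type*} {l : Filter ι}
    [l.IsCountablyGenerated] {T : ι → X →L[ℂ] F} {T₀ : X →L[ℂ] F}
    (h : ∀ x, Tendsto (fun i => T i x) l (𝓝 (T₀ x))) : ∃ C, ∀ᶠ i in l, ‖T i‖ ≤ C := by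
  by_contra! H
  obtain ⟨s, hs⟩ := l.exists_antitone_basis
  have H' : ∀ k : ℕ, ∃ i ∈ s k, (k : ℝ) < ‖T i‖ := fun k => by
    by_contra! hk
    exact (H k) (hs.1.eventually_iff.2 ⟨k, trivial, fun {i} hi => not_lt.2 (hk i hi)⟩)
  choose u hu hlt using H'
  have htend : Tendsto u atTop l := hs.tendsto hu
  obtain ⟨C, hC⟩ := banach_steinhaus (g := fun k => T (u k)) fun x => by
    obtain ⟨C, hC⟩ := ((h x).comp htend).norm.bddAbove_range
    exact ⟨C, fun k => hC ⟨k, rfl⟩⟩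
  obtain ⟨k, hk⟩ := exists_nat_gt C
  exact lt_irrefl _ ((hk.trans (hlt k)).trans_le (hC k))

/-- On a finite-dimensional domain the operator norm is controlled by the values on a basis. This is
what makes strong convergence of the boundary operators sufficient. -/
theorem tendsto_zero_of_tendsto_apply [FiniteDimensional ℂ F] {ι : Type*} {l : Filter ι}
    {T : ι → F →L[ℂ] X} (h : ∀ x, Tendsto (fun i => T i x) l (𝓝 0)) : Tendsto T l (𝓝 0) := by
  obtain ⟨C, hC, hb⟩ := (Module.finBasis ℂ F).exists_opNorm_le (F := X)
  rw [tendsto_zero_iff_norm_tendsto_zero]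
  have h1 : Tendsto (fun i => C * ∑ j, ‖T i (Module.finBasis ℂ F j)‖) l (𝓝 0) := by
    have := tendsto_finsetSum Finset.univ fun j (_ : j ∈ Finset.univ) =>
      (h (Module.finBasis ℂ F j)).norm
    simpa using this.const_mul C
  refine squeeze_zero (fun _ => norm_nonneg _) (fun i => hb (by positivity) fun j => ?_) h1
  exact Finset.single_le_sum (f := fun j => ‖T i (Module.finBasis ℂ F j)‖)
    (fun _ _ => norm_nonneg _) (Finset.mem_univ j)

theorem eventually_isUnit_of_tendsto_one {R : Type*} [NormedRing R] [HasSummableGeomSeries R]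
    {ι : Type*} {l : Filter ι} {V : ι → R} (h : Tendsto V l (𝓝 1)) :
    ∃ C, ∀ᶠ i in l, IsUnit (V i) ∧ ‖Ring.inverse (V i)‖ ≤ C := by
  have h1 := (NormedRing.inverse_continuousAt (1 : Rˣ)).tendsto.comp h
  refine ⟨‖Ring.inverse ((1 : Rˣ) : R)‖ + 1, ?_⟩
  filter_upwards [h (Units.nhds 1), h1.norm.eventually_le_const (lt_add_one _)] with i h2 h3
  exact ⟨h2, h3⟩

/-- If `(L₀, B₀) : X → Y × F` is bijective, where `F` has finite dimension, then the same holds,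
with uniform bounds for the inverses, for all `(L, B)` with `L` close to `L₀` in norm and `B` close
to `B₀` strongly. -/
theorem eventually_bijective_prod [CompleteSpace X] [CompleteSpace Y] [FiniteDimensional ℂ F]
    {ι : Type*} {l : Filter ι} [l.IsCountablyGenerated] {L : ι → X →L[ℂ] Y} {L₀ : X →L[ℂ] Y}
    {B : ι → X →L[ℂ] F} {B₀ : X →L[ℂ] F} (hL : Tendsto L l (𝓝 L₀))
    (hB : ∀ x, Tendsto (fun i => B i x) l (𝓝 (B₀ x)))
    (h0 : Function.Bijective (L₀.prod B₀)) :
    ∃ c C : ℝ, 0 < c ∧ 0 < C ∧ ∀ᶠ i in l, Function.Bijective ((L i).prod (B i)) ∧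
      ∀ x, c * (‖L i x‖ + ‖B i x‖) ≤ ‖x‖ ∧ ‖x‖ ≤ C * (‖L i x‖ + ‖B i x‖) := by
  have : CompleteSpace F := FiniteDimensional.complete ℂ F
  let T₀ : X ≃L[ℂ] Y × F := ContinuousLinearEquiv.ofBijective (L₀.prod B₀)
    (LinearMap.ker_eq_bot.2 h0.1) (LinearMap.range_eq_top.2 h0.2)
  have hT₀ : ∀ x, T₀ x = (L₀ x, B₀ x) := fun x => rfl
  -- `R` and `σ` solve the unperturbed problem with zero boundary data and with zero right-hand
  -- side, respectively.
  let R : Y →L[ℂ] X := (T₀.symm : Y × F →L[ℂ] X).comp (ContinuousLinearMap.inl ℂ Y F)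
  let σ : F →L[ℂ] X := (T₀.symm : Y × F →L[ℂ] X).comp (ContinuousLinearMap.inr ℂ Y F)
  have hR : ∀ x, R (L₀ x) + σ (B₀ x) = x := fun x => by
    change T₀.symm (L₀ x, 0) + T₀.symm (0, B₀ x) = x
    rw [← map_add, Prod.mk_add_mk, add_zero, zero_add, ← hT₀, T₀.symm_apply_apply]
  let P : ι → X →L[ℂ] F := fun i => B i - B₀
  have hP : ∀ x, Tendsto (fun i => P i x) l (𝓝 0) := fun x => by
    have := (hB x).sub_const (B₀ x)
    rwa [sub_self] at this
  obtain ⟨M, hM⟩ := eventually_norm_le_of_tendsto_apply (T₀ := 0) hP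
  obtain ⟨K, hK⟩ := eventually_norm_le_of_tendsto_apply hB
  have hPσ : Tendsto (fun i => (P i).comp σ) l (𝓝 0) :=
    tendsto_zero_of_tendsto_apply fun x => hP (σ x)
  have hLs : Tendsto (fun i => L i - L₀) l (𝓝 0) := by simpa using hL.sub_const L₀
  -- `P i ∘ R` need not be small, since `Y` may be infinite-dimensional; this triangular map
  -- subtracts its effect.
  let J : ι → Y × F →L[ℂ] Y × F := fun i =>
    (ContinuousLinearMap.fst ℂ Y F).prod (ContinuousLinearMap.snd ℂ Y F -
      ((P i).comp R).comp (ContinuousLinearMap.fst ℂ Y F))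
  have hJ : ∀ i, Function.Bijective (J i) := fun i => by
    refine Function.bijective_iff_has_inverse.2 ⟨fun z => (z.1, z.2 + P i (R z.1)), ?_, ?_⟩
    · rintro ⟨f, c⟩; simp [J]
    · rintro ⟨f, c⟩; simp [J]
  let V : ι → X →L[ℂ] X := fun i =>
    (T₀.symm : Y × F →L[ℂ] X).comp ((J i).comp ((L i).prod (B i)))
  have hV1 : ∀ i, V i = 1 + (T₀.symm : Y × F →L[ℂ] X).comp ((L i - L₀).prod
      (((P i).comp σ).comp B₀ - ((P i).comp R).comp (L i - L₀))) := fun i => by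
    ext x
    apply T₀.injective
    -- Splitting `P i x` along `x = R (L₀ x) + σ (B₀ x)` makes the correction in `J i` cancel all of
    -- `P i (R (L₀ x))`.
    have h1 := congrArg (P i) (hR x)
    rw [map_add] at h1
    have h2 : B i x = B₀ x + P i x := by simp [P]
    change T₀ (T₀.symm (L i x, B i x - P i (R (L i x)))) = T₀ (x + T₀.symm
      (L i x - L₀ x, P i (σ (B₀ x)) - P i (R (L i x - L₀ x))))
    rw [map_add, T₀.apply_symm_apply, T₀.apply_symm_apply, hT₀, Prod.mk_add_mk, h2, map_sub,
      map_sub, ← h1]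
    refine Prod.ext ?_ ?_ <;> simp only <;> abel
  have hV : Tendsto V l (𝓝 1) := by
    rw [tendsto_iff_norm_sub_tendsto_zero]
    have h1 : Tendsto (fun i => ‖(T₀.symm : Y × F →L[ℂ] X)‖ * (‖L i - L₀‖ +
        (‖(P i).comp σ‖ * ‖B₀‖ + M * ‖R‖ * ‖L i - L₀‖))) l (𝓝 0) := by
      have h2 := hLs.norm
      have h3 := hPσ.norm
      rw [norm_zero] at h2 h3
      simpa using (h2.add ((h3.mul_const ‖B₀‖).add (h2.const_mul (M * ‖R‖)))).const_mul
        ‖(T₀.symm : Y × F →L[ℂ] X)‖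
    refine squeeze_zero' (Eventually.of_forall fun _ => norm_nonneg _) ?_ h1
    filter_upwards [hM] with i hi
    rw [hV1, add_sub_cancel_left]
    refine (ContinuousLinearMap.opNorm_comp_le _ _).trans
      (mul_le_mul_of_nonneg_left ?_ (norm_nonneg _))
    rw [ContinuousLinearMap.opNorm_prod, Prod.norm_mk]
    refine max_le (le_add_of_nonneg_right ?_) (le_add_of_nonneg_of_le (norm_nonneg _) ?_)
    · have : 0 ≤ M := (norm_nonneg _).trans hi
      positivity
    · refine norm_sub_le_of_le (ContinuousLinearMap.opNorm_comp_le _ _)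
        ((ContinuousLinearMap.opNorm_comp_le _ _).trans ?_)
      refine mul_le_mul_of_nonneg_right ((ContinuousLinearMap.opNorm_comp_le _ _).trans ?_)
        (norm_nonneg _)
      exact mul_le_mul_of_nonneg_right hi (norm_nonneg _)
  obtain ⟨Q, hQ⟩ := eventually_isUnit_of_tendsto_one hV
  have hLb := hL.norm.eventually_le_const (lt_add_one ‖L₀‖)
  set S := ‖(T₀.symm : Y × F →L[ℂ] X)‖ with hS
  -- The first constant comes from bounds on `L i` and `B i`, the second from `x = (V i)⁻¹ (T₀⁻¹ (J
  -- i (L i x, B i x)))`. Absolute values and the final `+ 1` secure positivity without information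
  -- on the signs of `M`, `K`, `Q`.
  refine ⟨(‖L₀‖ + 1 + |K| + 1)⁻¹, |Q| * (S * (1 + |M| * ‖R‖)) + 1, by positivity,
    by positivity, ?_⟩
  filter_upwards [hM, hK, hQ, hLb] with i h1 h2 h3 h4
  have hVb : Function.Bijective (V i) := by
    refine Function.bijective_iff_has_inverse.2 ⟨⇑(Ring.inverse (V i)), fun x => ?_, fun x => ?_⟩
    · exact DFunLike.congr_fun (Ring.inverse_mul_cancel _ h3.1) x
    · exact DFunLike.congr_fun (Ring.mul_inverse_cancel _ h3.1) x
  refine ⟨?_, fun x => ⟨?_, ?_⟩⟩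
  · have h5 : Function.Bijective (J i ∘ (L i).prod (B i)) :=
      (Function.Bijective.of_comp_iff' T₀.symm.bijective _).1 hVb
    exact (Function.Bijective.of_comp_iff' (hJ i) _).1 h5
  · rw [inv_mul_le_iff₀ (by positivity)]
    have h5 := (L i).le_of_opNorm_le h4 x
    have h6 := (B i).le_of_opNorm_le (h2.trans (le_abs_self K)) x
    nlinarith [norm_nonneg x]
  · have h5 : Ring.inverse (V i) (V i x) = x :=
      DFunLike.congr_fun (Ring.inverse_mul_cancel _ h3.1) x
    have h6 := (Ring.inverse (V i)).le_of_opNorm_le (h3.2.trans (le_abs_self Q)) (V i x)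
    rw [h5] at h6
    have h7 : ‖V i x‖ ≤ S * ‖J i (L i x, B i x)‖ :=
      (T₀.symm : Y × F →L[ℂ] X).le_opNorm _
    have h8 : ‖J i (L i x, B i x)‖ ≤ (1 + |M| * ‖R‖) * (‖L i x‖ + ‖B i x‖) := by
      have h9 : ‖P i (R (L i x))‖ ≤ |M| * (‖R‖ * ‖L i x‖) :=
        ((P i).le_of_opNorm_le (h1.trans (le_abs_self M)) _).trans
          (mul_le_mul_of_nonneg_left (R.le_opNorm _) (abs_nonneg M))
      have h10 : J i (L i x, B i x) = (L i x, B i x - P i (R (L i x))) := rfl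
      have h11 : 0 ≤ |M| * ‖R‖ * ‖B i x‖ := by positivity
      have h12 : 0 ≤ |M| * ‖R‖ * ‖L i x‖ := by positivity
      rw [h10, Prod.norm_mk]
      refine max_le ?_ ((norm_sub_le _ _).trans ?_)
      · nlinarith [norm_nonneg (B i x)]
      · nlinarith [norm_nonneg (L i x)]
    calc ‖x‖ ≤ |Q| * (S * ((1 + |M| * ‖R‖) * (‖L i x‖ + ‖B i x‖))) := by
          refine h6.trans (mul_le_mul_of_nonneg_left (h7.trans ?_) (abs_nonneg Q))
          exact mul_le_mul_of_nonneg_left h8 (norm_nonneg _)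
      _ ≤ (|Q| * (S * (1 + |M| * ‖R‖)) + 1) * (‖L i x‖ + ‖B i x‖) := by
          nlinarith [norm_nonneg (L i x), norm_nonneg (B i x)]

end Perturbation

/-! ### Linear Volterra equations with integrable coefficients. -/

section Volterra

variable {E : Type*} [NormedAddCommGroup E] [NormedSpace ℝ E] {a b : ℝ}

theorem exists_integral_truncation_le {α : ℝ → ℝ}
    (hα : IntervalIntegrable α volume a b) {δ : ℝ} (hδ : 0 < δ) :
    ∃ M : ℝ, 0 < M ∧ ∫ s in a..b, max (α s - M) 0 ≤ δ := by
  have h1 : Tendsto (fun k : ℕ => ∫ s in a..b, max (α s - k) 0) atTop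
      (𝓝 (∫ _ in a..b, (0 : ℝ))) := by
    have hm := hα.aestronglyMeasurable_restrict_uIoc
    refine intervalIntegral.tendsto_integral_filter_of_dominated_convergence (fun s => |α s|)
      (Eventually.of_forall fun k => ?_) (Eventually.of_forall fun k => ?_) hα.abs ?_
    · exact ((hm.aemeasurable.sub_const _).max aemeasurable_const).aestronglyMeasurable
    · refine Eventually.of_forall fun s _ => ?_
      rw [Real.norm_eq_abs, abs_of_nonneg (le_max_right _ _)]
      refine max_le ?_ (abs_nonneg _)
      linarith [le_abs_self (α s), (Nat.cast_nonneg k : (0 : ℝ) ≤ k)]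
    · refine Eventually.of_forall fun s _ => tendsto_const_nhds.congr' ?_
      filter_upwards [eventually_ge_atTop ⌈α s⌉₊] with k hk
      exact (max_eq_right (sub_nonpos.2 (Nat.ceil_le.1 hk))).symm
  rw [intervalIntegral.integral_zero] at h1
  obtain ⟨k, hk, hk0⟩ := ((h1.eventually_le_const hδ).and (eventually_gt_atTop 0)).exists
  exact ⟨k, Nat.cast_pos.2 hk0, hk⟩

/-- Bound `α` by `M + max (α - M) 0` with the integral of the excess at most `1/4`. The weight is at
most `1` on the excess, and with `K = 4 M` the constant part integrates to at most `M / K = 1/4`. -/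
theorem exists_exp_weight (hab : a ≤ b) {α : ℝ → ℝ} (hα : IntervalIntegrable α volume a b) :
    ∃ K : ℝ, ∀ t ∈ Icc a b, ∫ s in a..t, Real.exp (-K * (t - s)) * α s ≤ 1 / 2 := by
  obtain ⟨M, hM, h⟩ := exists_integral_truncation_le hα (δ := 1 / 4) (by norm_num)
  refine ⟨4 * M, fun t ht => ?_⟩
  have hsub := hα.mono_Icc (left_mem_Icc.2 hab) ht
  have hmax : IntervalIntegrable (fun s => max (α s - M) 0) volume a b := by
    have h1 := hα.sub (intervalIntegrable_const (c := M))
    exact ⟨h1.1.pos_part, h1.2.pos_part⟩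
  have hexp : Continuous fun s => Real.exp (-(4 * M) * (t - s)) := by fun_prop
  have hexpM : IntervalIntegrable (fun s => Real.exp (-(4 * M) * (t - s)) * M) volume a t :=
    (hexp.mul continuous_const).intervalIntegrable a t
  have h1 : ∫ s in a..t, Real.exp (-(4 * M) * (t - s)) * α s ≤
      ∫ s in a..t, (Real.exp (-(4 * M) * (t - s)) * M + max (α s - M) 0) := by
    refine intervalIntegral.integral_mono_on ht.1 (hsub.continuousOn_mul hexp.continuousOn)
      (hexpM.add (hmax.mono_Icc (left_mem_Icc.2 hab) ht)) fun s hs => ?_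
    have h2 : Real.exp (-(4 * M) * (t - s)) ≤ 1 := by
      rw [Real.exp_le_one_iff]
      nlinarith [hs.2]
    have h3 := Real.exp_pos (-(4 * M) * (t - s))
    have h4 := le_max_left (α s - M) 0
    have h5 := le_max_right (α s - M) 0
    nlinarith
  have h2 : ∫ s in a..t, Real.exp (-(4 * M) * (t - s)) * M ≤ 1 / 4 := by
    have hd : ∀ s ∈ uIcc a t, HasDerivAt (fun s => Real.exp (-(4 * M) * (t - s)) / 4)
        (Real.exp (-(4 * M) * (t - s)) * M) s := fun s _ => by
      have := ((((hasDerivAt_id s).const_sub t).const_mul (-(4 * M))).exp).div_const 4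
      convert! this using 1
      simp
      ring
    rw [intervalIntegral.integral_eq_sub_of_hasDerivAt hd hexpM]
    have := Real.exp_pos (-(4 * M) * (t - a))
    simp only [sub_self, mul_zero, Real.exp_zero]
    linarith
  have h3 : ∫ s in a..t, max (α s - M) 0 ≤ ∫ s in a..b, max (α s - M) 0 :=
    intervalIntegral.integral_mono_interval le_rfl ht.1 ht.2
      (Eventually.of_forall fun s => le_max_right _ _) hmax
  rw [intervalIntegral.integral_add hexpM (hmax.mono_Icc (left_mem_Icc.2 hab) ht)] at h1
  linarith

theorem IntervalIntegrable.clm_apply_continuousOn (hab : a ≤ b) {A : ℝ → E →L[ℝ] E}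
    (hA : IntervalIntegrable A volume a b) {u : ℝ → E} (hu : ContinuousOn u (Icc a b)) :
    IntervalIntegrable (fun s => A s (u s)) volume a b := by
  rw [intervalIntegrable_iff_integrableOn_Icc_of_le hab] at hA
  have h1 : MemLp A 1 (volume.restrict (Icc a b)) := memLp_one_iff_integrable.2 hA
  have h2 : MemLp u ∞ (volume.restrict (Icc a b)) := IsSobolev.memLp_of_continuousOn hu
  exact intervalIntegrable_of_memLp_Icc le_rfl hab
    ((ContinuousLinearMap.id ℝ (E →L[ℝ] E)).memLp_of_bilin 1 h1 h2)

theorem continuousOn_integral_Icc (hab : a ≤ b) {g : ℝ → E}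
    (hg : IntervalIntegrable g volume a b) :
    ContinuousOn (fun t => ∫ s in a..t, g s) (Icc a b) := by
  simpa [uIcc_of_le hab] using (absolutelyContinuousOnInterval_integral hab hg).continuousOn

/-- A linear Volterra equation with integrable coefficient has a continuous solution. -/
theorem exists_volterra_solution [CompleteSpace E] (hab : a ≤ b) {A : ℝ → E →L[ℝ] E}
    (hA : IntervalIntegrable A volume a b) {G : ℝ → E} (hG : ContinuousOn G (Icc a b)) :
    ∃ z : ℝ → E, ContinuousOn z (Icc a b) ∧
      ∀ t ∈ Icc a b, z t = G t + ∫ s in a..t, A s (z s) := by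
  obtain ⟨K, hK⟩ := exists_exp_weight hab hA.norm
  -- The solution is sought as `z t = exp (K t) w t`: the sup norm of `w` is an exponentially
  -- weighted norm of `z`, in which the integral operator contracts by `1/2` on the whole interval
  -- at once.
  let u : C(Icc a b, E) → ℝ → E := fun w s => Real.exp (K * s) • IccExtend hab w s
  have hu : ∀ w, ContinuousOn (u w) (Icc a b) := fun w =>
    ((by fun_prop : Continuous fun s => Real.exp (K * s)).smul w.continuous.Icc_extend'
      ).continuousOn
  have hi : ∀ w, IntervalIntegrable (fun s => A s (u w s)) volume a b := fun w =>
    hA.clm_apply_continuousOn hab (hu w)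
  let φ : C(Icc a b, E) → ℝ → E := fun w t =>
    Real.exp (-K * t) • (G t + ∫ s in a..t, A s (u w s))
  have hφ : ∀ w, ContinuousOn (φ w) (Icc a b) := fun w =>
    (by fun_prop : Continuous fun t => Real.exp (-K * t)).continuousOn.smul
      (hG.add (continuousOn_integral_Icc hab (hi w)))
  let Φ : C(Icc a b, E) → C(Icc a b, E) := fun w =>
    ⟨(Icc a b).domRestrict (φ w), continuousOn_iff_continuous_domRestrict.1 (hφ w)⟩
  have hc : ContractingWith (1 / 2) Φ := by
    refine ⟨by norm_num, LipschitzWith.of_dist_le_mul fun w w' => ?_⟩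
    rw [ContinuousMap.dist_le (by positivity)]
    rintro ⟨t, ht⟩
    have ha : a ∈ Icc a b := left_mem_Icc.2 hab
    have e : φ w t - φ w' t =
        ∫ s in a..t, Real.exp (-K * (t - s)) • A s (IccExtend hab (w - w') s) := by
      change Real.exp (-K * t) • (G t + _) - Real.exp (-K * t) • (G t + _) = _
      rw [← smul_sub, add_sub_add_left_eq_sub, ← intervalIntegral.integral_sub
        ((hi w).mono_Icc ha ht) ((hi w').mono_Icc ha ht), ← intervalIntegral.integral_smul]
      refine intervalIntegral.integral_congr fun s _ => ?_
      have e1 : IccExtend hab (⇑w - ⇑w') s = IccExtend hab w s - IccExtend hab w' s := rfl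
      have e2 : Real.exp (-K * (t - s)) = Real.exp (-K * t) * Real.exp (K * s) := by
        rw [← Real.exp_add]
        congr 1
        ring
      simp only [u]
      rw [e1, e2, mul_smul, map_smul, map_smul, map_sub, smul_sub (Real.exp (K * s))]
    rw [dist_eq_norm]
    change ‖φ w t - φ w' t‖ ≤ _
    rw [e]
    have hint : IntervalIntegrable (fun s => Real.exp (-K * (t - s)) * ‖A s‖) volume a t :=
      (hA.norm.mono_Icc ha ht).continuousOn_mul
        (by fun_prop : Continuous fun s => Real.exp (-K * (t - s))).continuousOn
    calc _ ≤ ∫ s in a..t, (Real.exp (-K * (t - s)) * ‖A s‖) * dist w w' := by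
          refine intervalIntegral.norm_integral_le_of_norm_le ht.1
            (Eventually.of_forall fun s _ => ?_) (hint.mul_const _)
          rw [norm_smul, Real.norm_eq_abs, Real.abs_exp, mul_assoc]
          refine mul_le_mul_of_nonneg_left ((A s).le_opNorm_of_le ?_) (Real.exp_pos _).le
          rw [dist_eq_norm]
          exact (w - w').norm_coe_le_norm _
      _ = (∫ s in a..t, Real.exp (-K * (t - s)) * ‖A s‖) * dist w w' :=
          intervalIntegral.integral_mul_const _ _
      _ ≤ _ := by
          refine mul_le_mul_of_nonneg_right ?_ dist_nonneg
          simpa using hK t ht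
  have : Nonempty C(Icc a b, E) := ⟨0⟩
  set w := hc.fixedPoint with hw
  have hfix : Φ w = w := hc.fixedPoint_isFixedPt
  refine ⟨u w, hu w, fun t ht => ?_⟩
  have h1 : φ w t = w ⟨t, ht⟩ := DFunLike.congr_fun hfix ⟨t, ht⟩
  change Real.exp (K * t) • IccExtend hab w t = _
  rw [IccExtend_of_mem _ _ ht, ← h1, smul_smul, ← Real.exp_add]
  simp

end Volterra

/-! ### Regularity for the Cauchy problem. -/

namespace IsSobolev

variable {E : Type*} [NormedAddCommGroup E] [NormedSpace ℝ E] [FiniteDimensional ℝ E]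
  {N : ℕ} {p : ℝ≥0∞} {a b : ℝ}

/-- The Cauchy problem for the first-order system `z' = A z + f` with `A` and `f` of class `W_p^N`
has a solution of class `W_p^{N+1}`. -/
theorem exists_cauchy_solution (hp : 1 ≤ p) (hab : a < b) {A : ℝ → E →L[ℝ] E} {f : ℝ → E}
    (hA : IsSobolev N p a b A) (hf : IsSobolev N p a b f) (v : E) :
    ∃ z : ℝ → E, IsSobolev (N + 1) p a b z ∧
      IntervalIntegrable (fun s => A s (z s) + f s) volume a b ∧
      ∀ t ∈ Icc a b, z t = v + ∫ s in a..t, (A s (z s) + f s) := by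
  have : CompleteSpace E := FiniteDimensional.complete ℝ E
  have hAi := hA.intervalIntegrable hp hab
  have hfi := hf.intervalIntegrable hp hab
  obtain ⟨z, hz, h⟩ := exists_volterra_solution hab.le hAi
    (continuousOn_const.add (continuousOn_integral_Icc hab.le hfi) :
      ContinuousOn (fun t => v + ∫ s in a..t, f s) (Icc a b))
  have hAz := hAi.clm_apply_continuousOn hab.le hz
  have h' : ∀ t ∈ Icc a b, z t = v + ∫ s in a..t, (A s (z s) + f s) := fun t ht => by
    have ha : a ∈ Icc a b := left_mem_Icc.2 hab.le
    rw [intervalIntegral.integral_add (hAz.mono_Icc ha ht) (hfi.mono_Icc ha ht), h t ht, Pi.add_apply]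
    abel
  -- Bootstrap: continuity of `z` puts `A z + f` in `L_p`, so `z` has order `1`; afterwards each
  -- order of `z` passes to `A z + f`, as far as `A` and `f` allow, and integration gains the next.
  have hk : ∀ k ≤ N, IsSobolev (k + 1) p a b z := by
    intro k
    induction k with
    | zero =>
      intro _
      refine of_integral hp hab (N := 0) (MemLp.add ?_ (hf.memLp hab)) h'
      exact (ContinuousLinearMap.id ℝ (E →L[ℝ] E)).memLp_of_bilin (q := ∞) p (hA.memLp hab)
        (memLp_of_continuousOn hz)
    | succ k ih =>
      intro hk
      exact of_integral hp hab (add hab ((hA.of_le hab hk).bilin_succ hab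
        (ContinuousLinearMap.id ℝ (E →L[ℝ] E)) (ih (by omega))) (hf.of_le hab hk)) h'
  exact ⟨z, hk N le_rfl, hAz.add hfi, h'⟩

/-- Starting from `Y q`, each step back along the chain gains one order; `j` counts these steps. -/
theorem of_hasDerivWithinAt_chain (hab : a < b) {q : ℕ} {Y : ℕ → ℝ → E}
    (hY : ∀ k < q, ∀ t ∈ Icc a b, HasDerivWithinAt (Y k) (Y (k + 1) t) (Icc a b) t)
    (hq : IsSobolev (N + 1) p a b (Y q)) : IsSobolev (N + (q + 1)) p a b (Y 0) := by
  have h : ∀ j ≤ q, IsSobolev (N + j + 1) p a b (Y (q - j)) := by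
    intro j
    induction j with
    | zero => intro _; exact hq
    | succ j ih =>
      intro hj
      refine of_hasDerivWithinAt hab (ih (by omega)) fun t ht => ?_
      have := hY (q - (j + 1)) (by omega) t ht
      rwa [show q - (j + 1) + 1 = q - j by omega] at this
  simpa [add_assoc] using h q le_rfl

theorem iteratedDerivWithin_chain (hab : a < b) {q : ℕ} {Y : ℕ → ℝ → E}
    (hY : ∀ k < q, ∀ t ∈ Icc a b, HasDerivWithinAt (Y k) (Y (k + 1) t) (Icc a b) t) :
    ∀ k ≤ q, EqOn (iteratedDerivWithin k (Y 0) (Icc a b)) (Y k) (Icc a b) := by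
  intro k
  induction k with
  | zero => intro _ t _; simp
  | succ k ih =>
    intro hk t ht
    rw [iteratedDerivWithin_succ, derivWithin_congr (ih (by omega)) (ih (by omega) ht)]
    exact (hY k (by omega) t ht).derivWithin (uniqueDiffOn_Icc hab t ht)

end IsSobolev

/-! ### Companion system and unique solvability. -/

namespace BVP

variable {m n r : ℕ} {a b : ℝ} {hab : a < b} {p : ℝ≥0∞} [hp : Fact (1 ≤ p)]

/-- The inclusion of `ℂ^m` in `(ℂ^m)^{q+1}` as the last factor. -/
def lastL (m q : ℕ) : Vec m →L[ℝ] Fin (q + 1) → Vec m :=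
  ContinuousLinearMap.single ℝ (fun _ : Fin (q + 1) => Vec m) (Fin.last q)

/-- The nilpotent shift of `(ℂ^m)^{q+1}`, with value `(u₁, …, u_q, 0)` at `(u₀, …, u_q)`. -/
def shiftL (m q : ℕ) : (Fin (q + 1) → Vec m) →L[ℝ] Fin (q + 1) → Vec m :=
  ContinuousLinearMap.pi fun i =>
    if h : i.1 < q then ContinuousLinearMap.proj ⟨i.1 + 1, Nat.succ_lt_succ h⟩ else 0

/-- The contribution `u ↦ (0, …, 0, M u_j)` of a coefficient to the companion matrix. -/
def coeffL (m q : ℕ) (j : Fin (q + 1)) :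
    Mat m →L[ℝ] (Fin (q + 1) → Vec m) →L[ℝ] Fin (q + 1) → Vec m :=
  (ContinuousLinearMap.compL ℝ (Fin (q + 1) → Vec m) (Vec m) (Fin (q + 1) → Vec m)
    (lastL m q)).comp
    (((ContinuousLinearMap.compL ℝ (Fin (q + 1) → Vec m) (Vec m) (Vec m)).flip
      (ContinuousLinearMap.proj j)).comp (mulVecL m))

theorem coeffL_apply (q : ℕ) (j : Fin (q + 1)) (M : Mat m) (u : Fin (q + 1) → Vec m) :
    coeffL m q j M u = lastL m q (mulVecL m M (u j)) := rfl

theorem lastL_apply_last (q : ℕ) (v : Vec m) : lastL m q v (Fin.last q) = v := by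
  simp [lastL]

theorem lastL_apply_of_lt {q : ℕ} {i : Fin (q + 1)} (hi : i.1 < q) (v : Vec m) :
    lastL m q v i = 0 := by
  have : i ≠ Fin.last q := fun h => by simp [h] at hi
  simp [lastL, this]

theorem shiftL_apply_of_lt {q : ℕ} {i : Fin (q + 1)} (hi : i.1 < q) (u : Fin (q + 1) → Vec m) :
    shiftL m q u i = u ⟨i.1 + 1, Nat.succ_lt_succ hi⟩ := by
  simp [shiftL, hi]

theorem shiftL_apply_last (q : ℕ) (u : Fin (q + 1) → Vec m) :
    shiftL m q u (Fin.last q) = 0 := by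
  simp [shiftL]

/-- The vector `(y, y', …, y^(q))` solves the companion system. For `i < q` component `i` is a
primitive of the continuous component `i + 1`, so the chain of derivatives holds pointwise; only the
last row, which is the equation itself, holds almost everywhere. -/
theorem exists_cauchy_solution_succ {q : ℕ} (A : Fin (q + 1) → SobolevSpace (Mat m) hab n p)
    (f : SobolevSpace (Vec m) hab n p) (v : Fin (q + 1) → Vec m) :
    ∃ y : SobolevSpace (Vec m) hab (n + (q + 1)) p,
      diffOp A y =ᵐ[volume.restrict (Icc a b)] f ∧ ∀ j : Fin (q + 1), y.deriv j a = v j := by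
  let 𝒜 : ℝ → (Fin (q + 1) → Vec m) →L[ℝ] Fin (q + 1) → Vec m := fun t =>
    shiftL m q + ∑ j, coeffL m q j (-(A j t))
  have h𝒜 : IsSobolev n p a b 𝒜 :=
    (IsSobolev.const hab (shiftL m q)).add hab (IsSobolev.sum hab _ fun j _ =>
      IsSobolev.clm_comp hab (-coeffL m q j) (A j).isSobolev |>.congr hab fun t _ => by simp)
  obtain ⟨z, hz, hgi, hzi⟩ := IsSobolev.exists_cauchy_solution hp.out hab h𝒜
    (f.isSobolev.clm_comp hab (lastL m q)) v
  set g : ℝ → Fin (q + 1) → Vec m := fun s => 𝒜 s (z s) + lastL m q (f s) with hg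
  have hg_lt : ∀ (i : Fin (q + 1)) (hi : i.1 < q) s,
      g s i = z s ⟨i.1 + 1, Nat.succ_lt_succ hi⟩ := fun i hi s => by
    simp [hg, 𝒜, coeffL_apply, shiftL_apply_of_lt hi, lastL_apply_of_lt hi]
  have hg_last : ∀ s, g s (Fin.last q) = f s - ∑ j, mulVecL m (A j s) (z s j) := fun s => by
    simp [hg, 𝒜, coeffL_apply, shiftL_apply_last, lastL_apply_last]
    abel
  have hproj : ∀ (i : Fin (q + 1)) t, t ∈ Icc a b → z t i = v i + ∫ s in a..t, g s i := by
    intro i t ht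
    have h1 := (ContinuousLinearMap.proj (R := ℝ) (φ := fun _ : Fin (q + 1) => Vec m) i
      ).intervalIntegral_comp_comm (hgi.mono_Icc (left_mem_Icc.2 hab.le) ht)
    rw [hzi t ht, Pi.add_apply]
    exact congrArg (v i + ·) h1.symm
  have hzs : ∀ i, IsSobolev (n + 1) p a b fun t => z t i := fun i =>
    hz.clm_comp hab (ContinuousLinearMap.proj (R := ℝ) (φ := fun _ : Fin (q + 1) => Vec m) i)
  -- `Fin.ofNat` reduces indices modulo `q + 1`; only `k ≤ q` is used, where nothing wraps around.
  let Y : ℕ → ℝ → Vec m := fun k t => z t (Fin.ofNat (q + 1) k)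
  have hYi : ∀ i : Fin (q + 1), Y i = fun t => z t i := fun i => by
    ext t : 1
    simp [Y]
  have hYlast : Y q = fun t => z t (Fin.last q) := hYi (Fin.last q)
  have hY : ∀ k < q, ∀ t ∈ Icc a b, HasDerivWithinAt (Y k) (Y (k + 1) t) (Icc a b) t := by
    intro k hk t ht
    have e1 := hYi ⟨k, by omega⟩
    have e2 := hYi ⟨k + 1, by omega⟩
    simp only at e1 e2
    rw [e1, e2]
    refine IsSobolev.hasDerivWithinAt_of_integral hab (v := v ⟨k, by omega⟩) (hzs _).continuousOn
      (fun s hs => ?_) ht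
    rw [hproj _ s hs]
    congr 1
    exact intervalIntegral.integral_congr fun u _ => hg_lt ⟨k, by omega⟩ hk u
  have hchain := IsSobolev.iteratedDerivWithin_chain hab hY
  let y : SobolevSpace (Vec m) hab (n + (q + 1)) p := SobolevSpace.mk (Y 0)
    (IsSobolev.of_hasDerivWithinAt_chain hab hY (hYlast ▸ hzs _))
  have hyj : ∀ j : Fin (q + 1), ∀ t ∈ Icc a b, y.deriv j t = z t j := fun j t ht =>
    (hchain j (Nat.lt_succ_iff.1 j.2) ht).trans (congrFun (hYi j) t)
  refine ⟨y, ?_, fun j => ?_⟩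
  · have hgl : IntervalIntegrable (fun s => g s (Fin.last q)) volume a b :=
      ⟨(ContinuousLinearMap.proj (R := ℝ) (φ := fun _ : Fin (q + 1) => Vec m)
        (Fin.last q)).integrable_comp hgi.1, (ContinuousLinearMap.proj (R := ℝ)
        (φ := fun _ : Fin (q + 1) => Vec m) (Fin.last q)).integrable_comp hgi.2⟩
    filter_upwards [IsSobolev.ae_derivWithin_of_integral hab hgl (hproj (Fin.last q)),
      ae_restrict_mem measurableSet_Icc] with t h1 ht
    have e : y.deriv (q + 1) t = g t (Fin.last q) := by
      rw [← h1]
      change iteratedDerivWithin (q + 1) (Y 0) (Icc a b) t = _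
      rw [iteratedDerivWithin_succ, derivWithin_congr (hchain q le_rfl) (hchain q le_rfl ht),
        hYlast]
    change y.deriv (q + 1) t + ∑ j : Fin (q + 1), mulVecL m (A j t) (y.deriv j t) = f t
    have e' : ∑ j : Fin (q + 1), mulVecL m (A j t) (y.deriv j t) =
        ∑ j, mulVecL m (A j t) (z t j) :=
      Finset.sum_congr rfl fun j _ => congrArg (mulVecL m (A j t)) (hyj j t ht)
    rw [e, hg_last, e']
    abel
  · have ha := left_mem_Icc.2 hab.le
    rw [hyj j a ha, hproj j a ha, intervalIntegral.integral_same, add_zero]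

/-- The Cauchy problem for the equation `L y = f` has a solution. -/
theorem exists_cauchy_solution (hr : 1 ≤ r) (A : Fin r → SobolevSpace (Mat m) hab n p)
    (f : SobolevSpace (Vec m) hab n p) (v : Fin r → Vec m) :
    ∃ y : SobolevSpace (Vec m) hab (n + r) p,
      diffOp A y =ᵐ[volume.restrict (Icc a b)] f ∧ ∀ j : Fin r, y.deriv j a = v j := by
  obtain ⟨q, rfl⟩ := Nat.exists_eq_add_of_le' hr
  exact exists_cauchy_solution_succ A f v

/-- Derivatives of order below `r` are classical up to the endpoints, so additivity holds at every
point; initial values are thus linear in `y`. -/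
theorem deriv_add_apply (y z : SobolevSpace (Vec m) hab (n + r) p) (j : Fin r) {t : ℝ}
    (ht : t ∈ Icc a b) : (y + z).deriv j t = y.deriv j t + z.deriv j t := by
  have h : ∀ y : SobolevSpace (Vec m) hab (n + r) p, ContDiffWithinAt ℝ (j : ℕ) y (Icc a b) t :=
    fun y => by
      have h1 : IsSobolev ((j : ℕ) + 1) p a b y := y.isSobolev.of_le hab (by omega)
      exact h1.1 t ht
  exact iteratedDerivWithin_add ht (uniqueDiffOn_Icc hab) (h y) (h z)

/-- The initial values `(y(a), …, y^(r-1)(a))`. -/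
def initialValues : SobolevSpace (Vec m) hab (n + r) p →ₗ[ℂ] Fin r → Vec m where
  toFun y j := y.deriv j a
  map_add' y z := funext fun j => deriv_add_apply y z j (left_mem_Icc.2 hab.le)
  map_smul' c _ := funext fun j => congrFun (IsSobolev.iteratedDerivWithin_smul c j) a

theorem isSolution_iff {A : Fin r → SobolevSpace (Mat m) hab n p}
    {B : SobolevSpace (Vec m) hab (n + r) p →L[ℂ] Vec (r * m)} {f : SobolevSpace (Vec m) hab n p}
    {c : Vec (r * m)} {y : SobolevSpace (Vec m) hab (n + r) p} :
    IsSolution A B f c y ↔ diffOpCLM A y = SeparationQuotient.mk f ∧ B y = c := by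
  rw [IsSolution, eqOnInterval_iff, diffOpCLM_apply]

theorem mk_eq_mk_iff_eqOn (hr : 1 ≤ r) {y z : SobolevSpace (Vec m) hab (n + r) p} :
    SeparationQuotient.mk y = SeparationQuotient.mk z ↔ EqOn y z (Icc a b) := by
  obtain ⟨q, rfl⟩ := Nat.exists_eq_add_of_le' hr
  exact SobolevSpace.mk_eq_mk_iff_eqOn (N := n + q)

theorem initialValues_congr {y z : SobolevSpace (Vec m) hab (n + r) p}
    (h : EqOn y z (Icc a b)) : initialValues y = initialValues z :=
  funext fun _ => iteratedDerivWithin_congr h (left_mem_Icc.2 hab.le)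

/-- If the homogeneous problem has only the trivial solution, the problem is solvable. -/
theorem exists_solution_of_onlyTrivialSolution (hr : 1 ≤ r)
    {A : Fin r → SobolevSpace (Mat m) hab n p}
    {B : SobolevSpace (Vec m) hab (n + r) p →L[ℂ] Vec (r * m)} (h0 : OnlyTrivialSolution A B)
    (f : SobolevSpace (Vec m) hab n p) (c : Vec (r * m)) :
    ∃ y, diffOpCLM A y = SeparationQuotient.mk f ∧ B y = c := by
  have hsol : ∀ f v, ∃ y, diffOpCLM A y = SeparationQuotient.mk f ∧ initialValues y = v := by
    intro f v
    obtain ⟨y, h1, h2⟩ := exists_cauchy_solution hr A f v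
    exact ⟨y, SobolevSpace.mk_eq_mk_iff_ae.2 h1, funext h2⟩
  let K := LinearMap.ker (diffOpCLM A).toLinearMap
  have hsurj : LinearMap.range (initialValues.comp K.subtype) = ⊤ :=
    LinearMap.range_eq_top.2 fun v => by
      obtain ⟨y, h1, h2⟩ := hsol 0 v
      exact ⟨⟨y, h1⟩, h2⟩
  -- `σ` chooses homogeneous solutions linearly in their initial values. Existence for the Cauchy
  -- problem suffices here; its uniqueness is not needed.
  obtain ⟨σ, hσ⟩ := LinearMap.exists_rightInverse_of_surjective _ hsurj
  have hσ' : ∀ v, initialValues (σ v : SobolevSpace (Vec m) hab (n + r) p) = v := fun v =>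
    DFunLike.congr_fun hσ v
  have hker : ∀ v, diffOpCLM A (σ v) = 0 := fun v => (σ v).2
  let Bσ : (Fin r → Vec m) →ₗ[ℂ] Vec (r * m) := B.toLinearMap ∘ₗ K.subtype ∘ₗ σ
  have hinj : Function.Injective Bσ := by
    refine (injective_iff_map_eq_zero Bσ).2 fun v hv => ?_
    have h1 := h0 (σ v) (isSolution_iff.2 ⟨hker v, hv⟩)
    rw [← hσ' v, initialValues_congr (z := 0) h1, map_zero]
  have hdim : Module.finrank ℂ (Fin r → Vec m) = Module.finrank ℂ (Vec (r * m)) := by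
    simp [Module.finrank_pi_fintype]
  obtain ⟨y, hy, -⟩ := hsol f 0
  -- Both spaces have dimension `r * m`, so the injective `Bσ` is onto, and some homogeneous
  -- solution corrects the boundary values of `y`.
  obtain ⟨v, hv⟩ := (LinearMap.injective_iff_surjective_of_finrank_eq_finrank hdim).1 hinj (c - B y)
  refine ⟨y + σ v, ?_, ?_⟩
  · rw [map_add, hker, add_zero, hy]
  · rw [map_add]
    exact (congrArg (B y + ·) hv).trans (add_sub_cancel _ _)

/-- A continuous linear map to a separated space, on the separation quotient. -/
def separate {X Z : Type*} [SeminormedAddCommGroup X] [NormedSpace ℂ X] [NormedAddCommGroup Z]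
    [NormedSpace ℂ Z] (T : X →L[ℂ] Z) : SeparationQuotient X →L[ℂ] Z :=
  SeparationQuotient.liftCLM T fun _ _ h => (h.map T.continuous).eq

theorem separate_mk {X Z : Type*} [SeminormedAddCommGroup X] [NormedSpace ℂ X]
    [NormedAddCommGroup Z] [NormedSpace ℂ Z] (T : X →L[ℂ] Z) (x : X) :
    separate T (SeparationQuotient.mk x) = T x := rfl

theorem norm_separate_sub_le {X Z : Type*} [SeminormedAddCommGroup X] [NormedSpace ℂ X]
    [NormedAddCommGroup Z] [NormedSpace ℂ Z] (S T : X →L[ℂ] Z) :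
    ‖separate S - separate T‖ ≤ ‖S - T‖ :=
  ContinuousLinearMap.opNorm_le_bound _ (norm_nonneg _) fun x => by
    obtain ⟨x, rfl⟩ := SeparationQuotient.surjective_mk x
    exact (S - T).le_opNorm x

theorem bijective_of_onlyTrivialSolution (hr : 1 ≤ r)
    {A : Fin r → SobolevSpace (Mat m) hab n p}
    {B : SobolevSpace (Vec m) hab (n + r) p →L[ℂ] Vec (r * m)} (h0 : OnlyTrivialSolution A B) :
    Function.Bijective ((separate (diffOpCLM A)).prod (separate B)) := by
  constructor
  · refine (injective_iff_map_eq_zero _).2 fun x hx => ?_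
    obtain ⟨y, rfl⟩ := SeparationQuotient.surjective_mk x
    have h1 := Prod.ext_iff.1 hx
    exact (mk_eq_mk_iff_eqOn hr (z := 0)).2 (h0 y (isSolution_iff.2 h1))
  · rintro ⟨x, c⟩
    obtain ⟨f, rfl⟩ := SeparationQuotient.surjective_mk x
    obtain ⟨y, h1, h2⟩ := exists_solution_of_onlyTrivialSolution hr h0 f c
    exact ⟨SeparationQuotient.mk y, Prod.ext h1 h2⟩

theorem uniquelySolvable_of_bijective (hr : 1 ≤ r)
    {A : Fin r → SobolevSpace (Mat m) hab n p}
    {B : SobolevSpace (Vec m) hab (n + r) p →L[ℂ] Vec (r * m)}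
    (h : Function.Bijective ((separate (diffOpCLM A)).prod (separate B))) :
    UniquelySolvable A B := by
  intro f c
  constructor
  · obtain ⟨x, hx⟩ := h.2 (SeparationQuotient.mk f, c)
    obtain ⟨y, rfl⟩ := SeparationQuotient.surjective_mk x
    exact ⟨y, isSolution_iff.2 (Prod.ext_iff.1 hx)⟩
  · intro y z hy hz
    refine (mk_eq_mk_iff_eqOn hr).1 (h.1 (Prod.ext ?_ ?_))
    · exact (isSolution_iff.1 hy).1.trans (isSolution_iff.1 hz).1.symm
    · exact (isSolution_iff.1 hy).2.trans (isSolution_iff.1 hz).2.symm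

/-- Since `z` solves the problem, `f` and `c` are the images of `z`; by linearity the discrepancy is
the size of the image of `y - z`, to which the uniform two-sided bounds apply. -/
theorem discrepancy_eq {A : Fin r → SobolevSpace (Mat m) hab n p}
    {B : SobolevSpace (Vec m) hab (n + r) p →L[ℂ] Vec (r * m)} {f : SobolevSpace (Vec m) hab n p}
    {c : Vec (r * m)} {z : SobolevSpace (Vec m) hab (n + r) p} (hz : IsSolution A B f c z)
    (y : SobolevSpace (Vec m) hab (n + r) p) :
    discrepancy A B f c y = ‖separate (diffOpCLM A) (SeparationQuotient.mk (y - z))‖ +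
      ‖separate B (SeparationQuotient.mk (y - z))‖ := by
  rw [isSolution_iff] at hz
  rw [separate_mk, separate_mk, map_sub, map_sub, hz.1, hz.2]
  rfl

end BVP

end

/-! ### The perturbation theorem. -/

theorem theorem5 {m n r : ℕ} (hm : 1 ≤ m) (hr : 1 ≤ r) {a b : ℝ} (hab : a < b)
    {p : ℝ≥0∞} [Fact (1 ≤ p)] {ε₀ : ℝ} (hε₀ : 0 < ε₀)
    (A : ℝ → Fin r → SobolevSpace (BVP.Mat m) hab n p)
    (B : ℝ → SobolevSpace (BVP.Vec m) hab (n + r) p →L[ℂ] BVP.Vec (r * m))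
    (h0 : BVP.OnlyTrivialSolution (A 0) (B 0))
    (hI : ∀ j, Tendsto (fun ε => A ε j) (𝓝[>] 0) (𝓝 (A 0 j)))
    (hII : ∀ y, Tendsto (fun ε => B ε y) (𝓝[>] 0) (𝓝 (B 0 y))) :
    ∃ ε₁, 0 < ε₁ ∧ ε₁ < ε₀ ∧
      (∀ ε ∈ Ico 0 ε₁, BVP.UniquelySolvable (A ε) (B ε)) ∧
      ∃ ε₂ γ₁ γ₂ : ℝ, 0 < ε₂ ∧ ε₂ < ε₁ ∧ 0 < γ₁ ∧ 0 < γ₂ ∧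
        ∀ (f : ℝ → SobolevSpace (BVP.Vec m) hab n p) (c : ℝ → BVP.Vec (r * m))
          (y : ℝ → SobolevSpace (BVP.Vec m) hab (n + r) p),
          BVP.IsSolution (A 0) (B 0) (f 0) (c 0) (y 0) →
          ∀ ε ∈ Ioo 0 ε₂, BVP.IsSolution (A ε) (B ε) (f ε) (c ε) (y ε) →
            γ₁ * BVP.discrepancy (A ε) (B ε) (f ε) (c ε) (y 0) ≤ ‖y 0 - y ε‖ ∧
            ‖y 0 - y ε‖ ≤ γ₂ * BVP.discrepancy (A ε) (B ε) (f ε) (c ε) (y 0) := by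
  have hB : ∀ x, Tendsto (fun ε => BVP.separate (B ε) x) (𝓝[>] 0) (𝓝 (BVP.separate (B 0) x)) := by
    intro x
    obtain ⟨y, rfl⟩ := SeparationQuotient.surjective_mk x
    exact hII y
  have hL : Tendsto (fun ε => BVP.separate (BVP.diffOpCLM (A ε))) (𝓝[>] 0)
      (𝓝 (BVP.separate (BVP.diffOpCLM (A 0)))) := by
    have h1 := tendsto_iff_norm_sub_tendsto_zero.1 (BVP.tendsto_diffOpCLM (r := r) hI)
    exact tendsto_iff_norm_sub_tendsto_zero.2 (squeeze_zero (fun _ => norm_nonneg _)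
      (fun _ => BVP.norm_separate_sub_le _ _) h1)
  have hbij := BVP.bijective_of_onlyTrivialSolution hr h0
  obtain ⟨γ₁, γ₂, h1, h2, hev⟩ := eventually_bijective_prod hL hB hbij
  obtain ⟨δ, hδ, hev⟩ := mem_nhdsGT_iff_exists_Ioo_subset.1 hev
  have hmin : 0 < min δ ε₀ := lt_min hδ hε₀
  -- Halving `min δ ε₀` makes `ε₁` strictly smaller than `ε₀` and keeps every positive `ε < ε₁` in
  -- the range of the uniform bounds.
  have hlt : ∀ ε, 0 < ε → ε < min δ ε₀ / 2 → ε ∈ Ioo 0 δ := fun ε h3 h4 =>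
    ⟨h3, h4.trans ((half_lt_self hmin).trans_le (min_le_left _ _))⟩
  refine ⟨min δ ε₀ / 2, half_pos hmin, (half_lt_self hmin).trans_le (min_le_right _ _),
    fun ε hε => ?_, min δ ε₀ / 2 / 2, γ₁, γ₂, half_pos (half_pos hmin),
    half_lt_self (half_pos hmin), h1, h2, fun f c y _ ε hε hy => ?_⟩
  -- The right-sided neighbourhood does not contain `ε = 0`; there bijectivity comes directly from
  -- assumption (0).
  · rcases hε.1.eq_or_lt with rfl | h3
    · exact BVP.uniquelySolvable_of_bijective hr hbij
    · exact BVP.uniquelySolvable_of_bijective hr (hev (hlt ε h3 hε.2)).1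
  · rw [BVP.discrepancy_eq hy]
    exact (hev (hlt ε hε.1 (hε.2.trans (half_lt_self (half_pos hmin))))).2
      (SeparationQuotient.mk (y 0 - y ε))
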